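/- Let $d\in\mathbb N$, $s>0$, $T>0$. For $r>0$ let $(-\Delta)^{r}$ be the Fourier multiplier with symbol $|\xi|^{2r}$ (for the Fourier transform $\widehat f(\xi)=\int f(x)e^{-ix\cdot\xi}\,dx$, extended to $L^2$), and let $H^s=\{f\in L^2(\mathbb R^d;\mathbb C): (-\Delta)^{s/2}f\in L^2\}$ with norm $\|f\|_{L^2}+\|(-\Delta)^{s/2}f\|_{L^2}$. A solution of the Cauchy problem $$u_{tt}+(-\Delta)^su+a(x)u+b(x)u_t=0\ \text{ on }[0,T]\times\mathbb R^d,\qquad u(0)=u_0,\quad u_t(0)=u_1 \tag{P}$$ is a function $u\in C([0,T];H^s)\cap C^1([0,T];L^2)$ which satisfies the initial conditions and, for all $\varphi\in H^s$ and $t\in[0,T]$, $$\frac{d}{dt}\langle u_t(t),\varphi\rangle_{L^2}+\langle(-\Delta)^{s/2}u(t),(-\Delta)^{s/2}\varphi\rangle_{L^2}+\langle a\,u(t)+b\,u_t(t),\varphi\rangle_{L^2}=0$$ (one-sided derivatives at $t=0$ and $t=T$). For a net $(f_\varepsilon)_{\varepsilon\in(0,1]}$ in a normed space $X$, call it $X$-moderate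 if there are $N\in\mathbb N_0$ and $C$ with $\|f_\varepsilon\|_X\le C\varepsilon^{-N}$ for all $\varepsilon\in(0,1]$. A net $(u_\varepsilon)_{\varepsilon\in(0,1]}$ in $C([0,T];H^s)\cap C^1([0,T];L^2)$ is called a very weak solution with respect to nets $(a_\varepsilon),(b_\varepsilon),(u_{0,\varepsilon}),(u_{1,\varepsilon})$ if $a_\varepsilon,b_\varepsilon\ge0$; the nets $(a_\varepsilon),(b_\varepsilon)$ are $L^\infty$-moderate, $(u_{0,\varepsilon})$ is $H^s$-moderate and $(u_{1,\varepsilon})$ is $L^2$-moderate; for every $\varepsilon\in(0,1]$, $u_\varepsilon$ solves (P) with $a_\varepsilon,b_\varepsilon,u_{0,\varepsilon},u_{1,\varepsilon}$ in place of $a,b,u_0,u_1$; and there are $N\in\mathbb N_0$ and $C$ with $$\sup_{t\in[0,T]}\big(\|u_\varepsilon(t)\|_{L^2}+\|(-\Delta)^{s/2}u_\varepsilon(t)\|_{L^2}+\|\partial_tu_\varepsilon(t)\|_{L^2}\big)\le C\varepsilon^{-N}\quad\text{for all }\varepsilon\in(0,1].$$ **Theorem.** Let $\psi\in C_c^\infty(\mathbb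 R^d)$ with $\psi\ge0$ and $\int\psi=1$, and put $\psi_\varepsilon(x)=\varepsilon^{-d}\psi(x/\varepsilon)$. Let $a,b\in L^\infty(\mathbb R^d)$ be real-valued and non-negative, $u_0\in H^s$, $u_1\in L^2(\mathbb R^d;\mathbb C)$, and let $$a_\varepsilon=a*\psi_\varepsilon,\quad b_\varepsilon=b*\psi_\varepsilon,\quad u_{0,\varepsilon}=u_0*\psi_\varepsilon,\quad u_{1,\varepsilon}=u_1*\psi_\varepsilon .$$ Assume that $\|a_\varepsilon-a\|_{L^\infty}\to0$ and $\|b_\varepsilon-b\|_{L^\infty}\to0$ as $\varepsilon\to0^+$. Then (P) has a unique solution $u$; there is a very weak solution with respect to $(a_\varepsilon),(b_\varepsilon),(u_{0,\varepsilon}),(u_{1,\varepsilon})$; and every such very weak solution $(u_\varepsilon)$ satisfies $$\sup_{t\in[0,T]}\|u_\varepsilon(t)-u(t)\|_{L^2}\longrightarrow0\qquad\text{as }\varepsilon\to0^+ .$$ -/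

import Mathlib

open MeasureTheory Set Filter Topology FourierTransform
open scoped ENNReal ContDiff

noncomputable section

/-- Complex-valued square-integrable functions on `ℝ^d`. -/
abbrev L2Space (d : ℕ) : Type :=
  Lp ℂ 2 (volume : Measure (EuclideanSpace ℝ (Fin d)))

/-- The function `(2π|ξ|)^s f̂(ξ)`. With Mathlib's normalisation
`f̂(ξ) = ∫ f(x) exp(-2πi x·ξ) dx` of the Fourier transform, this is the Fourier transform of
`(-Δ)^(s/2) f`. -/
def fracSymbolMul {d : ℕ} (s : ℝ) (f : L2Space d) : EuclideanSpace ℝ (Fin d) → ℂ :=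
  fun ξ => (((2 * Real.pi * ‖ξ‖) ^ s : ℝ) : ℂ) * (𝓕 f : L2Space d) ξ

/-- The fractional Sobolev space `H^s(ℝ^d)`: all `f ∈ L²` with `|ξ|^s f̂ ∈ L²`. -/
def sobolevHs (d : ℕ) (s : ℝ) : Set (L2Space d) :=
  {f | MemLp (fracSymbolMul s f) 2 volume}

open Classical in
/-- `(-Δ)^(s/2) f = 𝓕⁻¹ ((2π|ξ|)^s f̂)` for `f ∈ H^s` (and the value `0`, never used, for the
other `f ∈ L²`). -/
def fracLaplacianHalf {d : ℕ} (s : ℝ) (f : L2Space d) : L2Space d :=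
  if h : MemLp (fracSymbolMul s f) 2 volume then 𝓕⁻ (h.toLp (fracSymbolMul s f)) else 0

/-- The norm `‖f‖_{L²} + ‖(-Δ)^(s/2) f‖_{L²}` of `H^s`. -/
def hsNorm {d : ℕ} (s : ℝ) (f : L2Space d) : ℝ :=
  ‖f‖ + ‖fracLaplacianHalf s f‖

/-- The time derivative on `[0,T]` (one-sided at the end points) of a curve in `L²`. -/
def timeDeriv {d : ℕ} (T : ℝ) (u : ℝ → L2Space d) (t : ℝ) : L2Space d :=
  derivWithin u (Icc 0 T) t

/-- `u ∈ C([0,T]; H^s) ∩ C¹([0,T]; L²)`. Continuity for the norm `hsNorm s` is continuity in `L²`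
of both `u` and `(-Δ)^(s/2) u`; the former is part of the `C¹` condition. -/
structure InEnergySpace {d : ℕ} (s T : ℝ) (u : ℝ → L2Space d) : Prop where
  mem_hs : ∀ t ∈ Icc 0 T, u t ∈ sobolevHs d s
  continuousOn_hs : ContinuousOn (fun t => fracLaplacianHalf s (u t)) (Icc 0 T)
  contDiffOn : ContDiffOn ℝ 1 u (Icc 0 T)

/-- `u ∈ C([0,T]; H^s) ∩ C¹([0,T]; L²)` solves the Cauchy problem
`u_tt + (-Δ)^s u + a u + b u_t = 0` on `[0,T] × ℝ^d`, `u(0) = u₀`, `u_t(0) = u₁`.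
The equation holds at every time in `H^{-s}`, the dual of `H^s`: for every `φ ∈ H^s`,
`d/dt ⟨φ, u_t⟩ = - ⟨(-Δ)^(s/2) φ, (-Δ)^(s/2) u⟩ - ⟨φ, a u + b u_t⟩`. -/
structure IsCauchySolution {d : ℕ} (s T : ℝ) (a b : EuclideanSpace ℝ (Fin d) → ℝ)
    (u₀ u₁ : EuclideanSpace ℝ (Fin d) → ℂ) (u : ℝ → L2Space d) : Prop where
  energySpace : InEnergySpace s T u
  equation : ∀ φ ∈ sobolevHs d s, ∀ t ∈ Icc 0 T,
    HasDerivWithinAt (fun τ => inner ℂ φ (timeDeriv T u τ))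
      (-(inner ℂ (fracLaplacianHalf s φ) (fracLaplacianHalf s (u t))
        + ∫ x, (starRingEnd ℂ) (φ x) * ((a x : ℂ) * u t x + (b x : ℂ) * timeDeriv T u t x)))
      (Icc 0 T) t
  initial_value : u 0 =ᵐ[volume] u₀
  initial_velocity : timeDeriv T u 0 =ᵐ[volume] u₁

/-- A Friedrichs mollifier: a non-negative test function of integral one. -/
structure IsFriedrichsMollifier {d : ℕ} (ψ : EuclideanSpace ℝ (Fin d) → ℝ) : Prop where
  contDiff : ContDiff ℝ ∞ ψ
  hasCompactSupport : HasCompactSupport ψ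
  nonneg : ∀ x, 0 ≤ ψ x
  integral_eq_one : ∫ x, ψ x = 1

/-- The mollifying net `ψ_ε(x) = ε^{-d} ψ(x/ε)`. -/
def mollifyingNet {d : ℕ} (ψ : EuclideanSpace ℝ (Fin d) → ℝ) (ε : ℝ) :
    EuclideanSpace ℝ (Fin d) → ℝ :=
  fun x => (ε ^ d)⁻¹ * ψ (ε⁻¹ • x)

/-- The regularisation `f_ε = f * ψ_ε`, that is `f_ε(x) = ∫ ψ_ε(y) f(x - y) dy`. -/
def regularise {d : ℕ} {F : Type*} [NormedAddCommGroup F] [NormedSpace ℝ F]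
    (ψ : EuclideanSpace ℝ (Fin d) → ℝ) (f : EuclideanSpace ℝ (Fin d) → F) (ε : ℝ) :
    EuclideanSpace ℝ (Fin d) → F :=
  convolution (mollifyingNet ψ ε) f (ContinuousLinearMap.lsmul ℝ ℝ) volume

/-- An `L^p`-moderate net: `‖f_ε‖_{L^p} ≤ C ε^{-N}` for all `ε ∈ (0,1]`. -/
def IsLpModerate {d : ℕ} {F : Type*} [NormedAddCommGroup F] (p : ℝ≥0∞)
    (f : ℝ → EuclideanSpace ℝ (Fin d) → F) : Prop :=
  ∃ (N : ℕ) (C : ℝ), ∀ ε ∈ Ioc (0 : ℝ) 1,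
    MemLp (f ε) p volume ∧ eLpNorm (f ε) p volume ≤ ENNReal.ofReal (C / ε ^ N)

/-- An `H^s`-moderate net: `‖f_ε‖_{H^s} ≤ C ε^{-N}` for all `ε ∈ (0,1]`. -/
def IsHsModerate {d : ℕ} (s : ℝ) (f : ℝ → EuclideanSpace ℝ (Fin d) → ℂ) : Prop :=
  ∃ (N : ℕ) (C : ℝ), ∀ ε ∈ Ioc (0 : ℝ) 1,
    ∃ g ∈ sobolevHs d s, g =ᵐ[volume] f ε ∧ hsNorm s g ≤ C / ε ^ N

/-- A `C₁`-moderate net: a net in `C([0,T]; H^s) ∩ C¹([0,T]; L²)` with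
`sup_t (‖u_ε(t)‖ + ‖(-Δ)^(s/2) u_ε(t)‖ + ‖∂_t u_ε(t)‖) ≤ C ε^{-N}` for all `ε ∈ (0,1]`. -/
def IsC1Moderate {d : ℕ} (s T : ℝ) (u : ℝ → ℝ → L2Space d) : Prop :=
  ∃ (N : ℕ) (C : ℝ), ∀ ε ∈ Ioc (0 : ℝ) 1,
    InEnergySpace s T (u ε) ∧
      ∀ t ∈ Icc 0 T, hsNorm s (u ε t) + ‖timeDeriv T (u ε) t‖ ≤ C / ε ^ N

/-- The net `(u_ε)` is a very weak solution of the Cauchy problem, with respect to the given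
approximating nets of the coefficients and of the data. -/
structure IsVeryWeakSolution {d : ℕ} (s T : ℝ) (a b : ℝ → EuclideanSpace ℝ (Fin d) → ℝ)
    (u₀ u₁ : ℝ → EuclideanSpace ℝ (Fin d) → ℂ) (u : ℝ → ℝ → L2Space d) : Prop where
  moderate_a : IsLpModerate ∞ a
  moderate_b : IsLpModerate ∞ b
  nonneg_a : ∀ ε ∈ Ioc (0 : ℝ) 1, 0 ≤ᵐ[volume] a ε
  nonneg_b : ∀ ε ∈ Ioc (0 : ℝ) 1, 0 ≤ᵐ[volume] b ε
  moderate_u₀ : IsHsModerate s u₀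
  moderate_u₁ : IsLpModerate 2 u₁
  solves : ∀ ε ∈ Ioc (0 : ℝ) 1, IsCauchySolution s T (a ε) (b ε) (u₀ ε) (u₁ ε) (u ε)
  moderate : IsC1Moderate s T u

end

/-!
Write `Λ = (-Δ)^(s/2)`, and let `g(Λ)` denote the Fourier multiplier with symbol `g((2π|ξ|)^s)`
(`specOp`). The coefficients act on `L²` as bounded operators `A`, `B` (`coeffOp`), so that the
equation is `u_tt + Λ² u + A u + B u_t = 0`, a bounded perturbation of the free evolution.

*Existence.* In the unknowns `(Λu, u_t)` the free evolution is the rotation by the angle `tΛ`.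
Undoing it leaves a linear ordinary differential equation in `L² × L² × L²` whose right-hand side
consists of bounded operators depending strongly continuously on time (`interactionField`); it is
solved by a contraction argument (`exists_solution_of_lipschitz`). That the resulting curves
satisfy the equation in `H^{-s}` follows by differentiating `cos(tΛ)φ` and `sin(tΛ)φ` for test
functions `φ ∈ H^s` (`hasDerivAt_specOp`, `IsForcedSolution.of_firstOrder`).

*Stability.* A solution of `u_tt + Λ² u + F = 0` in `H^{-s}` with continuous `F` in `L²` satisfies
the energy identity `d/dt (‖u_t‖² + ‖Λu‖²) = -2 Re ⟨u_t, F⟩`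
(`IsForcedSolution.hasDerivWithinAt_energy`): after truncation to frequencies with `(2π|ξ|)^s ≤ n`
all terms are differentiable in norm, and the integrated identity passes to the limit `n → ∞`.
Grönwall's inequality then bounds the full energy (`IsForcedSolution.energy_le`). For the
difference of two solutions with different coefficients and data this gives uniqueness, and a
bound of `sup_t ‖v - u‖²` by the energy distance of the data and the `L^∞` distances of the
coefficients (`IsCauchySolution.norm_sub_sq_le`).

*Regularisation.* On `L²`, convolution with `ψ_ε` is the Fourier multiplier with symbol `ψ̂(εξ)`
(`IsFriedrichsMollifier.mollify_ae_eq`). It is a contraction, commutes with `Λ`, and converges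
strongly to the identity since `ψ̂(0) = 1`. Hence the regularised data converge in `H^s × L²` and
all nets are bounded uniformly in `ε`; this yields a very weak solution, and the stability
estimate yields the convergence.
-/

/-! ### Multiplication operators and dominated convergence in `L²` -/

section MulL2

variable {α : Type*} [MeasurableSpace α] {μ : Measure α}

open Classical in
/-- Multiplication by the essentially bounded function `g`, as a bounded operator on `L²`
(and the value `0` if `g` is not essentially bounded). -/
noncomputable def mulL2 (μ : Measure α) (g : α → ℂ) : Lp ℂ 2 μ →L[ℂ] Lp ℂ 2 μ :=
  if h : MemLp g ∞ μ then (ContinuousLinearMap.mul ℂ ℂ).holderL μ ∞ 2 2 (h.toLp g) else 0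

theorem coeFn_mulL2 {g : α → ℂ} (hg : MemLp g ∞ μ) (f : Lp ℂ 2 μ) :
    mulL2 μ g f =ᵐ[μ] fun x => g x * f x := by
  rw [mulL2, dif_pos hg, ContinuousLinearMap.holderL_apply_apply]
  filter_upwards [ContinuousLinearMap.coeFn_holder (r := 2) (ContinuousLinearMap.mul ℂ ℂ)
    (hg.toLp g) f, hg.coeFn_toLp] with x hx hx'
  rw [hx, hx', ContinuousLinearMap.mul_apply']

theorem norm_mulL2_le {g : α → ℂ} (hg : MemLp g ∞ μ) (f : Lp ℂ 2 μ) :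
    ‖mulL2 μ g f‖ ≤ (eLpNorm g ∞ μ).toReal * ‖f‖ := by
  rw [mulL2, dif_pos hg, ContinuousLinearMap.holderL_apply_apply]
  refine ((ContinuousLinearMap.mul ℂ ℂ).norm_holder_apply_apply_le _ _).trans ?_
  rw [Lp.norm_toLp]
  have := ContinuousLinearMap.opNorm_mul_le ℂ ℂ
  gcongr
  exact mul_le_of_le_one_left ENNReal.toReal_nonneg this

theorem MeasureTheory.MemLp.top_of_norm_le {g : α → ℂ} {C : ℝ} (hg : AEStronglyMeasurable g μ)
    (h : ∀ x, ‖g x‖ ≤ C) : MemLp g ∞ μ :=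
  memLp_top_of_bound hg C (Eventually.of_forall h)

theorem norm_mulL2_le_of_bound {g : α → ℂ} {C : ℝ} (hg : AEStronglyMeasurable g μ)
    (h : ∀ x, ‖g x‖ ≤ C) (f : Lp ℂ 2 μ) : ‖mulL2 μ g f‖ ≤ C * ‖f‖ := by
  refine Lp.norm_le_mul_norm_of_ae_le_mul ?_
  filter_upwards [coeFn_mulL2 (MemLp.top_of_norm_le hg h) f] with x hx
  rw [hx, norm_mul]
  gcongr
  exact h x

theorem inner_mulL2_ofReal {g : α → ℝ} (hg : MemLp (fun x => (g x : ℂ)) ∞ μ) (f h : Lp ℂ 2 μ) :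
    inner ℂ (mulL2 μ (fun x => (g x : ℂ)) f) h = inner ℂ f (mulL2 μ (fun x => (g x : ℂ)) h) := by
  rw [L2.inner_def, L2.inner_def]
  refine integral_congr_ae ?_
  filter_upwards [coeFn_mulL2 hg f, coeFn_mulL2 hg h] with x hx hx'
  rw [hx, hx']
  simp only [RCLike.inner_apply, map_mul, Complex.conj_ofReal]
  ring

/-- Dominated convergence in `L²`. The functions `k i` represent the classes `G i`, so that the
pointwise limit makes sense along uncountable families. -/
theorem tendsto_zero_of_dominated_L2 {ι : Type*} {l : Filter ι} [l.IsCountablyGenerated]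
    {G : ι → Lp ℂ 2 μ} {k : ι → α → ℂ} (b : Lp ℂ 2 μ) (C : ℝ) (hk : ∀ i, G i =ᵐ[μ] k i)
    (hb : ∀ᶠ i in l, ∀ᵐ x ∂μ, ‖k i x‖ ≤ C * ‖b x‖)
    (h : ∀ᵐ x ∂μ, Tendsto (fun i => k i x) l (𝓝 0)) : Tendsto G l (𝓝 0) := by
  refine tendsto_of_seq_tendsto fun i hi => ?_
  rw [Lp.tendsto_Lp_iff_tendsto_eLpNorm']
  have hz : ∀ n, eLpNorm (⇑(G (i n)) - ⇑(0 : Lp ℂ 2 μ)) 2 μ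
      = (∫⁻ x, ‖G (i n) x‖ₑ ^ (2 : ℝ) ∂μ) ^ (1 / (2 : ℝ)) := by
    intro n
    rw [eLpNorm_congr_ae (g := G (i n)), eLpNorm_eq_lintegral_rpow_enorm_toReal (by simp) (by simp)]
    · simp
    · filter_upwards [Lp.coeFn_zero ℂ 2 μ] with x hx
      rw [Pi.sub_apply, hx, Pi.zero_apply, sub_zero]
  refine (tendsto_congr hz).2 ?_
  have hlim : Tendsto (fun n => ∫⁻ x, ‖G (i n) x‖ₑ ^ (2 : ℝ) ∂μ) atTop (𝓝 (∫⁻ _, 0 ∂μ)) := by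
    refine tendsto_lintegral_filter_of_dominated_convergence
      (fun x => ‖(C : ℂ) * b x‖ₑ ^ (2 : ℝ)) ?_ ?_ ?_ ?_
    · exact Eventually.of_forall fun n => (Lp.stronglyMeasurable (G (i n))).enorm.pow_const _
    · filter_upwards [hi.eventually hb] with n hn
      filter_upwards [hn, hk (i n)] with x hx hx'
      gcongr
      rw [hx', enorm_le_iff_norm_le, norm_mul, Complex.norm_real]
      refine hx.trans ?_
      gcongr
      exact le_abs_self C
    · have := ((Lp.memLp b).const_mul (C : ℂ)).eLpNorm_lt_top
      have h2 := lintegral_rpow_enorm_lt_top_of_eLpNorm_lt_top (by simp) (by simp) this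
      simpa using h2.ne
    · filter_upwards [h, ae_all_iff.2 fun n => hk (i n)] with x hx hx'
      have := ((hx.comp hi).enorm).ennrpow_const 2
      simpa [hx'] using this
  simpa using hlim.ennrpow_const (1 / 2)

end MulL2

/-! ### Curves in Hilbert space: weak derivatives and linear Cauchy problems -/

section Curves

/-- The integral of a continuous vector-valued function on `[0,T]` is a primitive of it. -/
theorem ContinuousOn.hasDerivWithinAt_integral {E : Type*} [NormedAddCommGroup E]
    [NormedSpace ℝ E] [CompleteSpace E] {T : ℝ} {G : ℝ → E} (hG : ContinuousOn G (Icc 0 T))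
    {t : ℝ} (ht : t ∈ Icc 0 T) :
    HasDerivWithinAt (fun τ => ∫ x in (0 : ℝ)..τ, G x) (G t) (Icc 0 T) t := by
  have h0 : (0 : ℝ) ∈ Icc 0 T := ⟨le_rfl, ht.1.trans ht.2⟩
  have := ODE.hasDerivWithinAt_picard_Icc (f := fun t _ => G t) (u := univ) (α := fun _ => (0 : E))
    h0 (hG.comp continuousOn_fst fun x hx => hx.1) continuousOn_const (by simp) 0 ht
  exact this.congr (fun τ _ => by simp [ODE.picard_apply]) (by simp [ODE.picard_apply])

theorem eq_of_hasDerivWithinAt_eq {E : Type*} [NormedAddCommGroup E]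
    [NormedSpace ℝ E] {T : ℝ} {f g f' : ℝ → E}
    (hf : ∀ t ∈ Icc 0 T, HasDerivWithinAt f (f' t) (Icc 0 T) t)
    (hg : ∀ t ∈ Icc 0 T, HasDerivWithinAt g (f' t) (Icc 0 T) t) (h0 : f 0 = g 0) :
    ∀ t ∈ Icc 0 T, f t = g t :=
  eq_of_has_deriv_right_eq (f' := f')
    (fun x hx => (hf x (mem_Icc_of_Ico hx)).mono_of_mem_nhdsWithin (Icc_mem_nhdsGE_of_mem hx))
    (fun x hx => (hg x (mem_Icc_of_Ico hx)).mono_of_mem_nhdsWithin (Icc_mem_nhdsGE_of_mem hx))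
    (fun x hx => (hf x hx).continuousWithinAt) (fun x hx => (hg x hx).continuousWithinAt) h0

/-- A curve in a Hilbert space whose weak derivative is continuous is differentiable in norm. -/
theorem hasDerivWithinAt_of_weak {H : Type*} [NormedAddCommGroup H] [InnerProductSpace ℂ H]
    [NormedSpace ℝ H] [CompleteSpace H] {T : ℝ} {p G : ℝ → H} (hG : ContinuousOn G (Icc 0 T))
    (h : ∀ φ : H, ∀ t ∈ Icc 0 T,
      HasDerivWithinAt (fun τ => inner ℂ φ (p τ)) (inner ℂ φ (G t)) (Icc 0 T) t)
    {t : ℝ} (ht : t ∈ Icc 0 T) : HasDerivWithinAt p (G t) (Icc 0 T) t := by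
  have hint : ∀ t ∈ Icc 0 T,
      HasDerivWithinAt (fun τ => p 0 + ∫ x in (0 : ℝ)..τ, G x) (G t) (Icc 0 T) t :=
    fun t ht => (hG.hasDerivWithinAt_integral ht).const_add _
  have heq : ∀ t ∈ Icc 0 T, p t = p 0 + ∫ x in (0 : ℝ)..t, G x := by
    intro t ht
    refine ext_inner_left ℂ fun φ => ?_
    refine eq_of_hasDerivWithinAt_eq (f := fun τ => inner ℂ φ (p τ))
      (g := fun τ => inner ℂ φ (p 0 + ∫ x in (0 : ℝ)..τ, G x)) (h φ) (fun t ht => ?_) ?_ t ht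
    · have := (hasDerivWithinAt_const t (Icc 0 T) φ).inner ℂ (hint t ht)
      rwa [inner_zero_left, add_zero] at this
    · simp
  exact (hint t ht).congr heq (heq t ht)

/-- The Cauchy problem `y' = f(t,y)`, `y(0) = y₀`, with `f` continuous and globally
Lipschitz in `y`, has a solution on `[0,T]`. The Picard map is a contraction for the norm
`sup_t exp (-λ t) ‖y(t)‖` with `λ` larger than the Lipschitz constant. -/
theorem exists_solution_of_lipschitz {Y : Type*} [NormedAddCommGroup Y] [NormedSpace ℝ Y]
    [CompleteSpace Y] {f : ℝ → Y → Y} (hf : Continuous (Function.uncurry f)) {M : ℝ} (hM : 0 ≤ M)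
    (hL : ∀ t y z, ‖f t y - f t z‖ ≤ M * ‖y - z‖) (T : ℝ) (y₀ : Y) :
    ∃ y : ℝ → Y, y 0 = y₀ ∧ ∀ t ∈ Icc 0 T, HasDerivWithinAt y (f t (y t)) (Icc 0 T) t := by
  rcases lt_or_ge T 0 with hT | hT
  · exact ⟨fun _ => y₀, rfl, fun t ht => absurd (ht.1.trans ht.2) hT.not_ge⟩
  set k : ℝ := 2 * M + 1 with hk
  have hk0 : 0 < k := by positivity
  -- the curve `exp (k t) z(t)` attached to a weighted curve `z`
  let ext : C(Icc (0 : ℝ) T, Y) → ℝ → Y := fun z t => Real.exp (k * t) • IccExtend hT z t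
  have hext : ∀ z, Continuous (ext z) := fun z => by
    have : Continuous (IccExtend hT z) := z.continuous.Icc_extend'
    fun_prop
  have hfc : ∀ z, Continuous fun τ => f τ (ext z τ) := fun z =>
    hf.comp (continuous_id.prodMk (hext z))
  have hpic : ∀ z, Continuous (fun t => ∫ τ in (0 : ℝ)..t, f τ (ext z τ)) := fun z =>
    intervalIntegral.continuous_primitive (fun a b => (hfc z).intervalIntegrable a b) 0
  let Φ : C(Icc (0 : ℝ) T, Y) → C(Icc (0 : ℝ) T, Y) := fun z =>
    ⟨fun t => Real.exp (-(k * t)) • (y₀ + ∫ τ in (0 : ℝ)..t, f τ (ext z τ)), by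
      have := hpic z
      fun_prop⟩
  have hcontr : ContractingWith (1 / 2) Φ := by
    refine ⟨by rw [← NNReal.coe_lt_coe]; norm_num, LipschitzWith.of_dist_le_mul fun z w => ?_⟩
    rw [ContinuousMap.dist_le (by positivity)]
    intro t
    have ht := t.2
    have hdiff : ∀ τ ∈ Icc (0 : ℝ) T,
        ‖f τ (ext z τ) - f τ (ext w τ)‖ ≤ M * dist z w * Real.exp (k * τ) := by
      intro τ hτ
      refine (hL _ _ _).trans ?_
      have : ‖ext z τ - ext w τ‖ ≤ Real.exp (k * τ) * dist z w := by
        simp only [ext, ← smul_sub, norm_smul, Real.norm_eq_abs, Real.abs_exp,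
          IccExtend_of_mem hT _ hτ]
        gcongr
        rw [← dist_eq_norm]
        exact ContinuousMap.dist_apply_le_dist _
      calc _ ≤ M * (Real.exp (k * τ) * dist z w) := by gcongr
        _ = _ := by ring
    have hint : ∫ τ in (0 : ℝ)..t, M * dist z w * Real.exp (k * τ)
        = M * dist z w * (k⁻¹ * (Real.exp (k * t) - 1)) := by
      rw [intervalIntegral.integral_const_mul, intervalIntegral.integral_comp_mul_left _ hk0.ne',
        integral_exp]
      simp
    have hnorm : ‖(∫ τ in (0 : ℝ)..t, f τ (ext z τ)) - ∫ τ in (0 : ℝ)..t, f τ (ext w τ)‖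
        ≤ M * dist z w * (k⁻¹ * Real.exp (k * t)) := by
      rw [← intervalIntegral.integral_sub ((hfc z).intervalIntegrable _ _)
        ((hfc w).intervalIntegrable _ _)]
      refine (intervalIntegral.norm_integral_le_of_norm_le ht.1
        (g := fun τ => M * dist z w * Real.exp (k * τ)) (Eventually.of_forall fun τ hτ =>
          hdiff τ ⟨hτ.1.le, hτ.2.trans ht.2⟩) (by
          apply Continuous.intervalIntegrable; fun_prop)).trans ?_
      rw [hint]
      gcongr
      linarith
    rw [dist_eq_norm]
    simp only [Φ, ContinuousMap.coe_mk, ← smul_sub, add_sub_add_left_eq_sub, norm_smul,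
      Real.norm_eq_abs, Real.abs_exp]
    have hMk : M * k⁻¹ ≤ 1 / 2 := by
      rw [← div_eq_mul_inv, div_le_iff₀ hk0]; linarith
    calc Real.exp (-(k * t)) * _ ≤ Real.exp (-(k * t)) *
          (M * dist z w * (k⁻¹ * Real.exp (k * t))) := by gcongr
      _ = M * k⁻¹ * dist z w * (Real.exp (-(k * t)) * Real.exp (k * t)) := by ring
      _ = M * k⁻¹ * dist z w := by rw [← Real.exp_add]; simp
      _ ≤ _ := by
        push_cast
        gcongr
  set z := ContractingWith.fixedPoint Φ hcontr
  have hz : Φ z = z := hcontr.fixedPoint_isFixedPt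
  have hez : ∀ t ∈ Icc (0 : ℝ) T, ext z t = y₀ + ∫ τ in (0 : ℝ)..t, f τ (ext z τ) := by
    intro t ht
    have h1 : z ⟨t, ht⟩ = Real.exp (-(k * t)) • (y₀ + ∫ τ in (0 : ℝ)..t, f τ (ext z τ)) := by
      conv_lhs => rw [← hz]
      rfl
    change Real.exp (k * t) • IccExtend hT z t = _
    rw [IccExtend_of_mem hT _ ht, h1, smul_smul, ← Real.exp_add]
    simp
  refine ⟨ext z, ?_, fun t ht => ?_⟩
  · simpa using hez 0 ⟨le_rfl, hT⟩
  · exact (((hfc z).continuousOn.hasDerivWithinAt_integral ht).const_add y₀).congr hez (hez t ht)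

end Curves

/-! ### Fourier multipliers and the functional calculus of `(-Δ)^(s/2)` -/

section FourierMultipliers

variable {d : ℕ}

/-- The Fourier multiplier `𝓕⁻¹ g 𝓕` with bounded symbol `g`, as an operator on `L²`. -/
noncomputable def fourierMult (g : EuclideanSpace ℝ (Fin d) → ℂ) : L2Space d →L[ℂ] L2Space d :=
  ((Lp.fourierTransformₗᵢ (EuclideanSpace ℝ (Fin d)) ℂ).symm : L2Space d →L[ℂ] L2Space d) ∘L
    mulL2 volume g ∘L
    ((Lp.fourierTransformₗᵢ (EuclideanSpace ℝ (Fin d)) ℂ) : L2Space d →L[ℂ] L2Space d)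

theorem fourierMult_eq (g : EuclideanSpace ℝ (Fin d) → ℂ) (f : L2Space d) :
    fourierMult g f = 𝓕⁻ (mulL2 volume g (𝓕 f)) := rfl

theorem fourier_fourierMult (g : EuclideanSpace ℝ (Fin d) → ℂ) (f : L2Space d) :
    𝓕 (fourierMult g f) = mulL2 volume g (𝓕 f) := by
  rw [fourierMult_eq, fourier_fourierInv_eq]

theorem fourier_injective_L2 {f g : L2Space d} (h : (𝓕 f : L2Space d) = 𝓕 g) : f = g :=
  (Lp.fourierTransformₗᵢ (EuclideanSpace ℝ (Fin d)) ℂ).injective h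

theorem fourier_sub_L2 (f g : L2Space d) : (𝓕 (f - g) : L2Space d) = 𝓕 f - 𝓕 g :=
  (Lp.fourierTransformₗᵢ (EuclideanSpace ℝ (Fin d)) ℂ).map_sub f g

theorem coeFn_fourier_fourierMult {g : EuclideanSpace ℝ (Fin d) → ℂ} (hg : MemLp g ∞ volume)
    (f : L2Space d) :
    (𝓕 (fourierMult g f) : L2Space d) =ᵐ[volume] fun ξ => g ξ * (𝓕 f : L2Space d) ξ := by
  rw [fourier_fourierMult]
  exact coeFn_mulL2 hg _

theorem norm_fourierMult_le {g : EuclideanSpace ℝ (Fin d) → ℂ} {C : ℝ}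
    (hg : AEStronglyMeasurable g volume) (h : ∀ x, ‖g x‖ ≤ C) (f : L2Space d) :
    ‖fourierMult g f‖ ≤ C * ‖f‖ := by
  rw [← Lp.norm_fourier_eq, fourier_fourierMult, ← Lp.norm_fourier_eq f]
  exact norm_mulL2_le_of_bound hg h _

theorem inner_fourierMult_ofReal {g : EuclideanSpace ℝ (Fin d) → ℝ}
    (hg : MemLp (fun x => (g x : ℂ)) ∞ volume) (f h : L2Space d) :
    inner ℂ (fourierMult (fun x => (g x : ℂ)) f) h
      = inner ℂ f (fourierMult (fun x => (g x : ℂ)) h) := by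
  rw [← Lp.inner_fourier_eq, ← Lp.inner_fourier_eq f, fourier_fourierMult, fourier_fourierMult,
    inner_mulL2_ofReal hg]

theorem fourierMult_fourierMult {g h gh : EuclideanSpace ℝ (Fin d) → ℂ} (hg : MemLp g ∞ volume)
    (hh : MemLp h ∞ volume) (hgh : MemLp gh ∞ volume) (he : ∀ x, g x * h x = gh x)
    (f : L2Space d) : fourierMult g (fourierMult h f) = fourierMult gh f := by
  refine fourier_injective_L2 (Lp.ext ?_)
  filter_upwards [coeFn_fourier_fourierMult hg (fourierMult h f), coeFn_fourier_fourierMult hh f,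
    coeFn_fourier_fourierMult hgh f] with x h1 h2 h3
  rw [h1, h2, h3, ← he, mul_assoc]

theorem fourierMult_one (f : L2Space d) : fourierMult (fun _ => 1) f = f := by
  refine fourier_injective_L2 (Lp.ext ?_)
  filter_upwards [coeFn_fourier_fourierMult (memLp_top_const 1) f] with x h1
  rw [h1, one_mul]

/-- Multipliers with uniformly bounded, pointwise convergent symbols converge strongly. -/
theorem tendsto_fourierMult {ι : Type*} {l : Filter ι} [l.IsCountablyGenerated]
    {g : ι → EuclideanSpace ℝ (Fin d) → ℂ} {g₀ : EuclideanSpace ℝ (Fin d) → ℂ} {C : ℝ}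
    (hg : ∀ i, AEStronglyMeasurable (g i) volume) (hg₀ : AEStronglyMeasurable g₀ volume)
    (hC : ∀ i x, ‖g i x‖ ≤ C) (hC₀ : ∀ x, ‖g₀ x‖ ≤ C)
    (h : ∀ x, Tendsto (fun i => g i x) l (𝓝 (g₀ x))) (f : L2Space d) :
    Tendsto (fun i => fourierMult (g i) f) l (𝓝 (fourierMult g₀ f)) := by
  have key : Tendsto (fun i => (𝓕 (fourierMult (g i) f - fourierMult g₀ f) : L2Space d)) l
      (𝓝 0) := by
    refine tendsto_zero_of_dominated_L2 (k := fun i x => (g i x - g₀ x) * (𝓕 f : L2Space d) x)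
      (𝓕 f : L2Space d) (C + C) (fun i => ?_) ?_ ?_
    · rw [fourier_sub_L2]
      filter_upwards [coeFn_fourier_fourierMult (MemLp.top_of_norm_le (hg i) (hC i)) f,
        coeFn_fourier_fourierMult (MemLp.top_of_norm_le hg₀ hC₀) f,
        Lp.coeFn_sub (𝓕 (fourierMult (g i) f) : L2Space d) (𝓕 (fourierMult g₀ f) : L2Space d)]
        with x h1 h2 h3
      rw [h3, Pi.sub_apply, h1, h2, sub_mul]
    · refine Eventually.of_forall fun i => Eventually.of_forall fun x => ?_
      rw [norm_mul]
      gcongr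
      exact (norm_sub_le _ _).trans (add_le_add (hC i x) (hC₀ x))
    · refine Eventually.of_forall fun x => ?_
      simpa using ((h x).sub_const (g₀ x)).mul_const ((𝓕 f : L2Space d) x)
  rw [tendsto_iff_norm_sub_tendsto_zero]
  simpa [Lp.norm_fourier_eq] using key.norm

/-- The symbol `(2π|ξ|)^s` of `(-Δ)^(s/2)`. -/
noncomputable def fracSymbol (s : ℝ) (ξ : EuclideanSpace ℝ (Fin d)) : ℝ := (2 * Real.pi * ‖ξ‖) ^ s

theorem fracSymbol_nonneg (s : ℝ) (ξ : EuclideanSpace ℝ (Fin d)) : 0 ≤ fracSymbol s ξ := by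
  unfold fracSymbol
  positivity

theorem measurable_fracSymbol (s : ℝ) :
    Measurable (fracSymbol s : EuclideanSpace ℝ (Fin d) → ℝ) := by
  unfold fracSymbol
  fun_prop

theorem fracSymbolMul_apply (s : ℝ) (f : L2Space d) (ξ : EuclideanSpace ℝ (Fin d)) :
    fracSymbolMul s f ξ = (fracSymbol s ξ : ℂ) * (𝓕 f : L2Space d) ξ := rfl

theorem coeFn_fourier_fracLaplacianHalf {s : ℝ} {f : L2Space d} (hf : f ∈ sobolevHs d s) :
    (𝓕 (fracLaplacianHalf s f) : L2Space d) =ᵐ[volume] fracSymbolMul s f := by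
  have hf' : MemLp (fracSymbolMul s f) 2 volume := hf
  rw [fracLaplacianHalf, dif_pos hf', fourier_fourierInv_eq]
  exact hf'.coeFn_toLp

theorem mem_sobolevHs_of_fourier_ae_eq {s : ℝ} {f w : L2Space d}
    (h : (𝓕 w : L2Space d) =ᵐ[volume] fracSymbolMul s f) : f ∈ sobolevHs d s :=
  (memLp_congr_ae h).1 (Lp.memLp _)

theorem fracLaplacianHalf_eq_of_fourier_ae_eq {s : ℝ} {f w : L2Space d}
    (h : (𝓕 w : L2Space d) =ᵐ[volume] fracSymbolMul s f) : fracLaplacianHalf s f = w :=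
  fourier_injective_L2 <| Lp.ext <|
    (coeFn_fourier_fracLaplacianHalf (mem_sobolevHs_of_fourier_ae_eq h)).trans h.symm

theorem fourier_fracLaplacianHalf_sub {s : ℝ} {f g : L2Space d} (hf : f ∈ sobolevHs d s)
    (hg : g ∈ sobolevHs d s) :
    (𝓕 (fracLaplacianHalf s f - fracLaplacianHalf s g) : L2Space d)
      =ᵐ[volume] fracSymbolMul s (f - g) := by
  rw [fourier_sub_L2]
  filter_upwards [coeFn_fourier_fracLaplacianHalf hf, coeFn_fourier_fracLaplacianHalf hg,
    Lp.coeFn_sub (𝓕 (fracLaplacianHalf s f) : L2Space d) (𝓕 (fracLaplacianHalf s g) : L2Space d),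
    Lp.coeFn_sub (𝓕 f : L2Space d) (𝓕 g : L2Space d)] with x h1 h2 h3 h4
  rw [h3, Pi.sub_apply, h1, h2, fracSymbolMul_apply, fracSymbolMul_apply, fracSymbolMul_apply,
    fourier_sub_L2, h4, Pi.sub_apply, mul_sub]

theorem sub_mem_sobolevHs {s : ℝ} {f g : L2Space d} (hf : f ∈ sobolevHs d s)
    (hg : g ∈ sobolevHs d s) : f - g ∈ sobolevHs d s :=
  mem_sobolevHs_of_fourier_ae_eq (fourier_fracLaplacianHalf_sub hf hg)

theorem fracLaplacianHalf_sub {s : ℝ} {f g : L2Space d} (hf : f ∈ sobolevHs d s)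
    (hg : g ∈ sobolevHs d s) :
    fracLaplacianHalf s (f - g) = fracLaplacianHalf s f - fracLaplacianHalf s g :=
  fracLaplacianHalf_eq_of_fourier_ae_eq (fourier_fracLaplacianHalf_sub hf hg)

theorem fourier_fourierMult_fracLaplacianHalf {s : ℝ} {f : L2Space d} (hf : f ∈ sobolevHs d s)
    {g : EuclideanSpace ℝ (Fin d) → ℂ} (hg : MemLp g ∞ volume) :
    (𝓕 (fourierMult g (fracLaplacianHalf s f)) : L2Space d)
      =ᵐ[volume] fracSymbolMul s (fourierMult g f) := by
  filter_upwards [coeFn_fourier_fourierMult hg (fracLaplacianHalf s f),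
    coeFn_fourier_fourierMult hg f, coeFn_fourier_fracLaplacianHalf hf] with x h1 h2 h3
  rw [h1, fracSymbolMul_apply, h2, h3, fracSymbolMul_apply]
  ring

/-- Fourier multipliers preserve `H^s`. -/
theorem fourierMult_mem_sobolevHs {s : ℝ} {f : L2Space d} (hf : f ∈ sobolevHs d s)
    {g : EuclideanSpace ℝ (Fin d) → ℂ} (hg : MemLp g ∞ volume) :
    fourierMult g f ∈ sobolevHs d s :=
  mem_sobolevHs_of_fourier_ae_eq (fourier_fourierMult_fracLaplacianHalf hf hg)

/-- Fourier multipliers commute with `(-Δ)^(s/2)`. -/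
theorem fracLaplacianHalf_fourierMult {s : ℝ} {f : L2Space d} (hf : f ∈ sobolevHs d s)
    {g : EuclideanSpace ℝ (Fin d) → ℂ} (hg : MemLp g ∞ volume) :
    fracLaplacianHalf s (fourierMult g f) = fourierMult g (fracLaplacianHalf s f) :=
  fracLaplacianHalf_eq_of_fourier_ae_eq (fourier_fourierMult_fracLaplacianHalf hf hg)

end FourierMultipliers

section FunctionalCalculus

variable {d : ℕ} {s : ℝ}

/-- The operator `g((-Δ)^(s/2))` for a bounded function `g : ℝ → ℝ`. -/
noncomputable def specOp (s : ℝ) (g : ℝ → ℝ) : L2Space d →L[ℂ] L2Space d :=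
  fourierMult fun ξ => (g (fracSymbol s ξ) : ℂ)

theorem aestronglyMeasurable_spec {g : ℝ → ℝ} (hg : Measurable g) :
    AEStronglyMeasurable (fun ξ : EuclideanSpace ℝ (Fin d) => (g (fracSymbol s ξ) : ℂ)) volume :=
  (Complex.measurable_ofReal.comp (hg.comp (measurable_fracSymbol s))).aestronglyMeasurable

theorem memLp_spec {g : ℝ → ℝ} {C : ℝ} (hg : Measurable g) (hC : ∀ x, 0 ≤ x → |g x| ≤ C) :
    MemLp (fun ξ : EuclideanSpace ℝ (Fin d) => (g (fracSymbol s ξ) : ℂ)) ∞ volume :=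
  MemLp.top_of_norm_le (aestronglyMeasurable_spec hg) fun ξ => by
    simpa using hC _ (fracSymbol_nonneg s ξ)

/-- The spectral cut-off of `(-Δ)^(s/2)` at height `n`. -/
noncomputable def cutOff (s : ℝ) (n : ℕ) : L2Space d →L[ℂ] L2Space d :=
  specOp s ((Iic (n : ℝ)).indicator 1)

/-- The bounded operator that agrees with `(-Δ)^(s/2)` on frequencies below the height `n`. -/
noncomputable def cutLaplacian (s : ℝ) (n : ℕ) : L2Space d →L[ℂ] L2Space d :=
  specOp s ((Iic (n : ℝ)).indicator id)

theorem memLp_cutOff (n : ℕ) : MemLp (fun ξ : EuclideanSpace ℝ (Fin d) =>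
    (((Iic (n : ℝ)).indicator 1 (fracSymbol s ξ) : ℝ) : ℂ)) ∞ volume :=
  memLp_spec (C := 1) (measurable_one.indicator measurableSet_Iic) fun x _ => by
    by_cases h : x ∈ Iic (n : ℝ) <;> simp [h, indicator]

theorem memLp_cutLaplacian (n : ℕ) : MemLp (fun ξ : EuclideanSpace ℝ (Fin d) =>
    (((Iic (n : ℝ)).indicator id (fracSymbol s ξ) : ℝ) : ℂ)) ∞ volume :=
  memLp_spec (C := n) (measurable_id.indicator measurableSet_Iic) fun x hx => by
    by_cases h : x ≤ n <;> simp [h, indicator, abs_of_nonneg hx]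

theorem norm_cutOff_le (n : ℕ) (f : L2Space d) : ‖cutOff s n f‖ ≤ ‖f‖ := by
  have := norm_fourierMult_le (C := 1) (memLp_cutOff (s := s) n).1 (fun x => ?_) f
  · simpa using! this
  · by_cases h : fracSymbol s x ∈ Iic (n : ℝ) <;> simp [h, indicator]

theorem inner_cutOff (n : ℕ) (f g : L2Space d) :
    inner ℂ (cutOff s n f) g = inner ℂ f (cutOff s n g) :=
  inner_fourierMult_ofReal (memLp_cutOff n) f g

theorem inner_cutLaplacian (n : ℕ) (f g : L2Space d) :
    inner ℂ (cutLaplacian s n f) g = inner ℂ f (cutLaplacian s n g) :=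
  inner_fourierMult_ofReal (memLp_cutLaplacian n) f g

theorem cutOff_cutLaplacian (n : ℕ) (f : L2Space d) :
    cutOff s n (cutLaplacian s n f) = cutLaplacian s n f :=
  fourierMult_fourierMult (memLp_cutOff n) (memLp_cutLaplacian n) (memLp_cutLaplacian n)
    (fun x => by by_cases h : fracSymbol s x ≤ n <;> simp [h, indicator]) f

theorem tendsto_cutOff (f : L2Space d) : Tendsto (fun n => cutOff s n f) atTop (𝓝 f) := by
  have := tendsto_fourierMult (l := atTop) (C := 1) (g₀ := fun _ => 1)
    (fun n => (memLp_cutOff (s := s) n).1) aestronglyMeasurable_const (fun n x => ?_) (by simp)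
    (fun x => ?_) f
  · rwa [fourierMult_one] at this
  · by_cases h : fracSymbol s x ∈ Iic (n : ℝ) <;> simp [h, indicator]
  · refine tendsto_const_nhds.congr' ?_
    obtain ⟨N, hN⟩ := exists_nat_ge (fracSymbol s x)
    filter_upwards [eventually_ge_atTop N] with n hn
    have : fracSymbol s x ≤ n := hN.trans (by exact_mod_cast hn)
    simp [indicator, this]

theorem fourier_cutLaplacian (n : ℕ) (f : L2Space d) :
    (𝓕 (cutLaplacian s n f) : L2Space d) =ᵐ[volume] fracSymbolMul s (cutOff s n f) := by
  filter_upwards [coeFn_fourier_fourierMult (memLp_cutLaplacian (s := s) n) f,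
    coeFn_fourier_fourierMult (memLp_cutOff (s := s) n) f] with x h1 h2
  rw [fracSymbolMul_apply]
  refine h1.trans ((?_ : _ = _).trans (congrArg _ h2.symm))
  by_cases h : fracSymbol s x ≤ n <;> simp [h, indicator]

theorem cutOff_mem_sobolevHs (n : ℕ) (f : L2Space d) : cutOff s n f ∈ sobolevHs d s :=
  mem_sobolevHs_of_fourier_ae_eq (fourier_cutLaplacian n f)

theorem fracLaplacianHalf_cutOff (n : ℕ) (f : L2Space d) :
    fracLaplacianHalf s (cutOff s n f) = cutLaplacian s n f :=
  fracLaplacianHalf_eq_of_fourier_ae_eq (fourier_cutLaplacian n f)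

theorem cutLaplacian_eq_cutOff (n : ℕ) {f : L2Space d} (hf : f ∈ sobolevHs d s) :
    cutLaplacian s n f = cutOff s n (fracLaplacianHalf s f) := by
  rw [← fracLaplacianHalf_cutOff]
  exact fracLaplacianHalf_fourierMult hf (memLp_cutOff n)

/-- `(-Δ)^(s/2)` is a closed operator: it is determined by its frequency truncations. -/
theorem fourier_ae_eq_of_cut {u w : L2Space d} (h : ∀ n, cutOff s n w = cutLaplacian s n u) :
    (𝓕 w : L2Space d) =ᵐ[volume] fracSymbolMul s u := by
  filter_upwards [ae_all_iff.2 fun n => coeFn_fourier_fourierMult (memLp_cutLaplacian (s := s) n) u,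
    ae_all_iff.2 fun n => coeFn_fourier_fourierMult (memLp_cutOff (s := s) n) w] with x h1 h2
  obtain ⟨N, hN⟩ := exists_nat_ge (fracSymbol s x)
  have h3 := (h2 N).symm.trans ((congrArg (fun f : L2Space d => (𝓕 f : L2Space d) x) (h N)).trans
    (h1 N))
  simpa [indicator, hN, fracSymbolMul_apply] using h3

theorem memLp_spec_mul {g : ℝ → ℝ} {C : ℝ} (hg : Measurable g) (hC : ∀ x, |g x| ≤ C) (t : ℝ) :
    MemLp (fun ξ : EuclideanSpace ℝ (Fin d) => (g (t * fracSymbol s ξ) : ℂ)) ∞ volume :=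
  memLp_spec (g := fun x => g (t * x)) (hg.comp (measurable_const_mul t)) fun x _ => hC (t * x)

theorem continuous_specOp {g : ℝ → ℝ} {C : ℝ} (hg : Continuous g) (hC : ∀ x, |g x| ≤ C)
    (f : L2Space d) : Continuous fun t => specOp s (fun x => g (t * x)) f := by
  refine continuous_iff_continuousAt.2 fun t => ?_
  refine tendsto_fourierMult (C := C) (fun t => (memLp_spec_mul hg.measurable hC t).1)
    (memLp_spec_mul hg.measurable hC t).1 (fun t x => by simpa using hC _)
    (fun x => by simpa using hC _) (fun x => ?_) f
  have : Continuous fun t => (g (t * fracSymbol s x) : ℂ) := by fun_prop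
  exact this.tendsto t

/-- If `g` is differentiable with bounded derivative and `f ∈ H^s`, then `t ↦ g(t (-Δ)^(s/2)) f`
is differentiable in `L²`. -/
theorem hasDerivAt_specOp {g g' : ℝ → ℝ} {C C' : ℝ} (hC : ∀ x, |g x| ≤ C)
    (hg : ∀ x, HasDerivAt g (g' x) x) (hg' : Measurable g') (hC' : ∀ x, |g' x| ≤ C')
    {f : L2Space d} (hf : f ∈ sobolevHs d s) (t : ℝ) :
    HasDerivAt (fun t => specOp s (fun x => g (t * x)) f)
      (specOp s (fun x => g' (t * x)) (fracLaplacianHalf s f)) t := by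
  have hgm : Measurable g := (continuous_iff_continuousAt.2 fun x => (hg x).continuousAt).measurable
  have hlip : ∀ x y, |g x - g y| ≤ C' * |x - y| := fun x y =>
    Convex.norm_image_sub_le_of_norm_hasDerivWithin_le (fun x _ => (hg x).hasDerivWithinAt)
      (fun x _ => hC' x) convex_univ (mem_univ y) (mem_univ x)
  rw [hasDerivAt_iff_tendsto_slope, tendsto_iff_norm_sub_tendsto_zero]
  let A : ℝ → L2Space d := fun τ => specOp s (fun x => g (τ * x)) f
  let B : L2Space d := specOp s (fun x => g' (t * x)) (fracLaplacianHalf s f)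
  have key : Tendsto (fun τ => (𝓕 (slope A t τ - B) : L2Space d)) (𝓝[≠] t) (𝓝 0) := by
    refine tendsto_zero_of_dominated_L2
      (k := fun τ x => ((((τ - t)⁻¹ * (g (τ * fracSymbol s x) - g (t * fracSymbol s x))
        - g' (t * fracSymbol s x) * fracSymbol s x) : ℝ) : ℂ) * (𝓕 f : L2Space d) x)
      (𝓕 (fracLaplacianHalf s f) : L2Space d) (C' + C') (fun τ => ?_) ?_ ?_
    · have e : (𝓕 (slope A t τ - B) : L2Space d)
          = ((τ - t)⁻¹ : ℝ) • (𝓕 (A τ) - 𝓕 (A t) : L2Space d) - 𝓕 B := by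
        rw [fourier_sub_L2, slope_def_module, ← fourier_sub_L2 (A τ) (A t)]
        congr 1
        exact ((Lp.fourierTransformₗᵢ (EuclideanSpace ℝ (Fin d)) ℂ : _ ≃ₗᵢ[ℂ] _) :
          L2Space d →L[ℂ] L2Space d).map_smul_of_tower (τ - t)⁻¹ (A τ - A t)
      rw [e]
      filter_upwards [coeFn_fourier_fourierMult (memLp_spec_mul (s := s) hgm hC τ) f,
        coeFn_fourier_fourierMult (memLp_spec_mul (s := s) hgm hC t) f,
        coeFn_fourier_fourierMult (memLp_spec_mul (s := s) hg' hC' t) (fracLaplacianHalf s f),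
        coeFn_fourier_fracLaplacianHalf hf,
        Lp.coeFn_sub (((τ - t)⁻¹ : ℝ) • (𝓕 (A τ) - 𝓕 (A t) : L2Space d)) (𝓕 B : L2Space d),
        Lp.coeFn_smul ((τ - t)⁻¹ : ℝ) (𝓕 (A τ) - 𝓕 (A t) : L2Space d),
        Lp.coeFn_sub (𝓕 (A τ) : L2Space d) (𝓕 (A t) : L2Space d)] with x h1 h2 h3 h4 h5 h6 h7
      have h1' : (𝓕 (A τ) : L2Space d) x = _ := h1
      have h2' : (𝓕 (A t) : L2Space d) x = _ := h2
      have h3' : (𝓕 B : L2Space d) x = _ := h3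
      rw [h5, Pi.sub_apply, h6, Pi.smul_apply, h7, Pi.sub_apply, h1', h2', h3', h4,
        fracSymbolMul_apply, Complex.real_smul]
      push_cast
      ring
    · filter_upwards [self_mem_nhdsWithin] with τ hτ
      filter_upwards [coeFn_fourier_fracLaplacianHalf hf] with x hx
      rw [hx, fracSymbolMul_apply, norm_mul, norm_mul, ← mul_assoc, Complex.norm_real,
        Complex.norm_real, Real.norm_eq_abs, Real.norm_eq_abs,
        abs_of_nonneg (fracSymbol_nonneg s x)]
      gcongr
      refine (abs_sub _ _).trans ?_
      have hne : 0 < |τ - t| := abs_pos.2 (sub_ne_zero.2 hτ)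
      have h1 := hlip (τ * fracSymbol s x) (t * fracSymbol s x)
      rw [← sub_mul, abs_mul (τ - t), abs_of_nonneg (fracSymbol_nonneg s x)] at h1
      rw [abs_mul, abs_mul, abs_inv, abs_of_nonneg (fracSymbol_nonneg s x), add_mul]
      have h2 := fracSymbol_nonneg s x
      refine add_le_add ?_ (mul_le_mul_of_nonneg_right (hC' _) h2)
      rw [inv_mul_le_iff₀ hne]
      linarith
    · refine Eventually.of_forall fun x => ?_
      have h1 : HasDerivAt (fun τ => g (τ * fracSymbol s x))
          (g' (t * fracSymbol s x) * fracSymbol s x) t :=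
        (hg _).comp t (by simpa using (hasDerivAt_id t).mul_const (fracSymbol s x))
      have h2 := (hasDerivAt_iff_tendsto_slope.1 h1).sub_const
        (g' (t * fracSymbol s x) * fracSymbol s x)
      rw [sub_self] at h2
      have h3 := ((Complex.continuous_ofReal.tendsto _).comp h2).mul_const ((𝓕 f : L2Space d) x)
      simpa [slope_def_module, Function.comp_def] using h3
  simpa [Lp.norm_fourier_eq] using! key.norm

end FunctionalCalculus

/-! ### The energy identity and stability -/

section Energy

variable {d : ℕ} {s T : ℝ}

theorem InEnergySpace.hasDerivWithinAt {u : ℝ → L2Space d} (hu : InEnergySpace s T u) {t : ℝ}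
    (ht : t ∈ Icc 0 T) : HasDerivWithinAt u (timeDeriv T u t) (Icc 0 T) t :=
  (hu.contDiffOn.differentiableOn one_ne_zero t ht).hasDerivWithinAt

theorem InEnergySpace.continuousOn_timeDeriv {u : ℝ → L2Space d} (hu : InEnergySpace s T u)
    (hT : 0 < T) : ContinuousOn (timeDeriv T u) (Icc 0 T) :=
  hu.contDiffOn.continuousOn_derivWithin (uniqueDiffOn_Icc hT) le_rfl

theorem timeDeriv_eq {u u' : ℝ → L2Space d} (hT : 0 < T) {t : ℝ} (ht : t ∈ Icc 0 T)
    (h : HasDerivWithinAt u (u' t) (Icc 0 T) t) : timeDeriv T u t = u' t :=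
  h.derivWithin (uniqueDiffOn_Icc hT t ht)

theorem InEnergySpace.of_hasDerivWithinAt {u u' w : ℝ → L2Space d} (hT : 0 < T)
    (hu : ∀ t ∈ Icc 0 T, HasDerivWithinAt u (u' t) (Icc 0 T) t)
    (hu' : ContinuousOn u' (Icc 0 T)) (hmem : ∀ t ∈ Icc 0 T, u t ∈ sobolevHs d s)
    (hw : ∀ t ∈ Icc 0 T, fracLaplacianHalf s (u t) = w t) (hwc : ContinuousOn w (Icc 0 T)) :
    InEnergySpace s T u where
  mem_hs := hmem
  continuousOn_hs := hwc.congr hw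
  contDiffOn := by
    rw [show (1 : WithTop ℕ∞) = 0 + 1 from rfl,
      contDiffOn_succ_iff_derivWithin (uniqueDiffOn_Icc hT)]
    refine ⟨fun t ht => (hu t ht).differentiableWithinAt, by simp, ?_⟩
    rw [contDiffOn_zero]
    exact hu'.congr fun t ht => timeDeriv_eq hT ht (hu t ht)

theorem InEnergySpace.sub {u w : ℝ → L2Space d} (hT : 0 < T) (hu : InEnergySpace s T u)
    (hw : InEnergySpace s T w) : InEnergySpace s T (fun t => u t - w t) :=
  .of_hasDerivWithinAt hT
    (fun _ ht => (hu.hasDerivWithinAt ht).sub (hw.hasDerivWithinAt ht))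
    ((hu.continuousOn_timeDeriv hT).sub (hw.continuousOn_timeDeriv hT))
    (fun t ht => sub_mem_sobolevHs (hu.mem_hs t ht) (hw.mem_hs t ht))
    (fun t ht => fracLaplacianHalf_sub (hu.mem_hs t ht) (hw.mem_hs t ht))
    (hu.continuousOn_hs.sub hw.continuousOn_hs)

theorem timeDeriv_sub {u w : ℝ → L2Space d} (hT : 0 < T) (hu : InEnergySpace s T u)
    (hw : InEnergySpace s T w) {t : ℝ} (ht : t ∈ Icc 0 T) :
    timeDeriv T (fun t => u t - w t) t = timeDeriv T u t - timeDeriv T w t :=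
  timeDeriv_eq (u' := fun t => timeDeriv T u t - timeDeriv T w t) hT ht
    ((hu.hasDerivWithinAt ht).sub (hw.hasDerivWithinAt ht))

/-- `u` solves `u_tt + (-Δ)^s u + F = 0` on `[0,T]` in `H^{-s}`, where the forcing term `F` is a
continuous curve in `L²`. -/
structure IsForcedSolution (s T : ℝ) (F u : ℝ → L2Space d) : Prop where
  energySpace : InEnergySpace s T u
  continuousOn_forcing : ContinuousOn F (Icc 0 T)
  equation : ∀ φ ∈ sobolevHs d s, ∀ t ∈ Icc 0 T,
    HasDerivWithinAt (fun τ => inner ℂ φ (timeDeriv T u τ))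
      (-(inner ℂ (fracLaplacianHalf s φ) (fracLaplacianHalf s (u t)) + inner ℂ φ (F t)))
      (Icc 0 T) t

theorem IsForcedSolution.sub {F G u w : ℝ → L2Space d} (hT : 0 < T) (hu : IsForcedSolution s T F u)
    (hw : IsForcedSolution s T G w) :
    IsForcedSolution s T (fun t => F t - G t) (fun t => u t - w t) where
  energySpace := hu.energySpace.sub hT hw.energySpace
  continuousOn_forcing := hu.continuousOn_forcing.sub hw.continuousOn_forcing
  equation φ hφ t ht := by
    have hsub : ∀ τ ∈ Icc 0 T, inner ℂ φ (timeDeriv T (fun t => u t - w t) τ)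
        = inner ℂ φ (timeDeriv T u τ) - inner ℂ φ (timeDeriv T w τ) := fun τ hτ => by
      rw [timeDeriv_sub hT hu.energySpace hw.energySpace hτ, inner_sub_right]
    refine (((hu.equation φ hφ t ht).sub (hw.equation φ hφ t ht)).congr hsub
      (hsub t ht)).congr_deriv ?_
    rw [fracLaplacianHalf_sub (hu.energySpace.mem_hs t ht) (hw.energySpace.mem_hs t ht),
      inner_sub_right, inner_sub_right]
    ring

/-- A continuous linear map over `ℂ` commutes with real derivatives of curves. -/
theorem HasDerivWithinAt.clm_apply_L2 {u : ℝ → L2Space d} {u' : L2Space d} {S : Set ℝ} {t : ℝ}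
    (h : HasDerivWithinAt u u' S t) (A : L2Space d →L[ℂ] L2Space d) :
    HasDerivWithinAt (fun τ => A (u τ)) (A u') S t := by
  have := (A.restrictScalars ℝ).hasFDerivAt.comp_hasDerivWithinAt t h
  simpa using! this

/-- Frequency truncations of the velocity are differentiable in `L²`, not only in `H^{-s}`. -/
theorem IsForcedSolution.hasDerivWithinAt_cutOff {F u : ℝ → L2Space d}
    (hu : IsForcedSolution s T F u) (n : ℕ) {t : ℝ} (ht : t ∈ Icc 0 T) :
    HasDerivWithinAt (fun τ => cutOff s n (timeDeriv T u τ))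
      (-(cutLaplacian s n (fracLaplacianHalf s (u t)) + cutOff s n (F t))) (Icc 0 T) t := by
  refine hasDerivWithinAt_of_weak
    (G := fun t => -(cutLaplacian s n (fracLaplacianHalf s (u t)) + cutOff s n (F t))) ?_ ?_ ht
  · exact (((cutLaplacian s n).continuous.comp_continuousOn hu.energySpace.continuousOn_hs).add
      ((cutOff s n).continuous.comp_continuousOn hu.continuousOn_forcing)).neg
  · intro φ t ht
    have := hu.equation _ (cutOff_mem_sobolevHs n φ) t ht
    rw [fracLaplacianHalf_cutOff] at this
    simpa only [inner_cutOff, inner_cutLaplacian, inner_neg_right, inner_add_right] using this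

theorem hasDerivWithinAt_norm_sq_L2 {f : ℝ → L2Space d} {f' : L2Space d} {S : Set ℝ} {t : ℝ}
    (hf : HasDerivWithinAt f f' S t) :
    HasDerivWithinAt (fun τ => ‖f τ‖ ^ 2) (2 * (inner ℂ (f t) f').re) S t := by
  have h := Complex.reCLM.hasFDerivAt.comp_hasDerivWithinAt t (hf.inner ℂ hf)
  have he : ∀ τ, ‖f τ‖ ^ 2 = (Complex.reCLM ∘ fun t => inner ℂ (f t) (f t)) τ := fun τ =>
    norm_sq_eq_re_inner (𝕜 := ℂ) (f τ)
  refine (h.congr_deriv ?_).congr (fun τ _ => he τ) (he t)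
  have e := congrArg Complex.re (inner_conj_symm (𝕜 := ℂ) (f t) f')
  rw [Complex.conj_re] at e
  rw [Complex.reCLM_apply, Complex.add_re, e]
  ring

/-- The energy identity at frequencies below the height `n`. The terms with `(-Δ)^(s/2)` cancel
because the truncations are symmetric. -/
theorem IsForcedSolution.truncated_energy {F u : ℝ → L2Space d}
    (hu : IsForcedSolution s T F u) (n : ℕ) {t : ℝ} (ht : t ∈ Icc 0 T) :
    HasDerivWithinAt (fun τ => ‖cutOff s n (timeDeriv T u τ)‖ ^ 2 + ‖cutLaplacian s n (u τ)‖ ^ 2)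
      (-(2 * (inner ℂ (cutOff s n (timeDeriv T u t)) (cutOff s n (F t))).re)) (Icc 0 T) t := by
  have h1 := hasDerivWithinAt_norm_sq_L2 (hu.hasDerivWithinAt_cutOff n ht)
  have h2 := hasDerivWithinAt_norm_sq_L2
    ((hu.energySpace.hasDerivWithinAt ht).clm_apply_L2 (cutLaplacian s n))
  refine (h1.add h2).congr_deriv ?_
  have e1 : inner ℂ (cutOff s n (timeDeriv T u t)) (cutLaplacian s n (fracLaplacianHalf s (u t)))
      = inner ℂ (timeDeriv T u t) (cutLaplacian s n (fracLaplacianHalf s (u t))) := by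
    rw [inner_cutOff, cutOff_cutLaplacian]
  have e2 : inner ℂ (cutLaplacian s n (u t)) (cutLaplacian s n (timeDeriv T u t))
      = inner ℂ (cutLaplacian s n (fracLaplacianHalf s (u t))) (timeDeriv T u t) := by
    rw [cutLaplacian_eq_cutOff n (hu.energySpace.mem_hs t ht), inner_cutOff, cutOff_cutLaplacian,
      inner_cutLaplacian]
  have e3 := congrArg Complex.re (inner_conj_symm (𝕜 := ℂ) (timeDeriv T u t)
    (cutLaplacian s n (fracLaplacianHalf s (u t))))
  rw [Complex.conj_re] at e3
  rw [e2, inner_neg_right, inner_add_right, e1, Complex.neg_re, Complex.add_re, e3]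
  ring

/-- The energy identity `d/dt (‖u_t‖² + ‖(-Δ)^(s/2) u‖²) = - 2 Re ⟨u_t, F⟩`. It holds for the
truncated energies and survives the passage to the limit in its integrated form. -/
theorem IsForcedSolution.hasDerivWithinAt_energy {F u : ℝ → L2Space d} (hT : 0 < T)
    (hu : IsForcedSolution s T F u) {t : ℝ} (ht : t ∈ Icc 0 T) :
    HasDerivWithinAt (fun τ => ‖timeDeriv T u τ‖ ^ 2 + ‖fracLaplacianHalf s (u τ)‖ ^ 2)
      (-(2 * (inner ℂ (timeDeriv T u t) (F t)).re)) (Icc 0 T) t := by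
  have hv := hu.energySpace.continuousOn_timeDeriv hT
  have hF := hu.continuousOn_forcing
  let R : ℕ → ℝ → ℝ := fun n τ =>
    -(2 * (inner ℂ (cutOff s n (timeDeriv T u τ)) (cutOff s n (F τ))).re)
  let E : ℕ → ℝ → ℝ := fun n τ =>
    ‖cutOff s n (timeDeriv T u τ)‖ ^ 2 + ‖cutLaplacian s n (u τ)‖ ^ 2
  have hR : ∀ n, ContinuousOn (R n) (Icc 0 T) := fun n =>
    ((Complex.continuous_re.comp_continuousOn
      (((cutOff s n).continuous.comp_continuousOn hv).inner
        ((cutOff s n).continuous.comp_continuousOn hF))).const_smul (2 : ℝ)).neg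
  have hRlim : ContinuousOn (fun τ => -(2 * (inner ℂ (timeDeriv T u τ) (F τ)).re)) (Icc 0 T) :=
    ((Complex.continuous_re.comp_continuousOn (hv.inner hF)).const_smul (2 : ℝ)).neg
  have hEn : ∀ n, ∀ τ ∈ Icc 0 T, E n τ = E n 0 + ∫ x in (0 : ℝ)..τ, R n x := fun n =>
    eq_of_hasDerivWithinAt_eq (f' := R n) (fun τ hτ => hu.truncated_energy n hτ)
      (fun τ hτ => ((hR n).hasDerivWithinAt_integral hτ).const_add _) (by simp)
  have hElim : ∀ τ ∈ Icc 0 T, Tendsto (fun n => E n τ) atTop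
      (𝓝 (‖timeDeriv T u τ‖ ^ 2 + ‖fracLaplacianHalf s (u τ)‖ ^ 2)) := by
    intro τ hτ
    simp only [E, cutLaplacian_eq_cutOff _ (hu.energySpace.mem_hs τ hτ)]
    exact ((tendsto_cutOff _).norm.pow 2).add ((tendsto_cutOff _).norm.pow 2)
  have hlim : ∀ τ ∈ Icc 0 T, ‖timeDeriv T u τ‖ ^ 2 + ‖fracLaplacianHalf s (u τ)‖ ^ 2
      = (‖timeDeriv T u 0‖ ^ 2 + ‖fracLaplacianHalf s (u 0)‖ ^ 2)
        + ∫ x in (0 : ℝ)..τ, -(2 * (inner ℂ (timeDeriv T u x) (F x)).re) := by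
    intro τ hτ
    have hsub : uIcc 0 τ ⊆ Icc 0 T := by
      rw [uIcc_of_le hτ.1]
      exact Icc_subset_Icc_right hτ.2
    have hsub' : uIoc 0 τ ⊆ Icc 0 T := uIoc_subset_uIcc.trans hsub
    refine tendsto_nhds_unique (hElim τ hτ) ?_
    simp_rw [hEn _ τ hτ]
    refine (hElim 0 ⟨le_rfl, hT.le⟩).add ?_
    refine intervalIntegral.tendsto_integral_filter_of_dominated_convergence
      (fun x => 2 * (‖timeDeriv T u x‖ * ‖F x‖)) ?_ ?_ ?_ ?_
    · exact Eventually.of_forall fun n =>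
        ((hR n).mono hsub').aestronglyMeasurable measurableSet_uIoc
    · refine Eventually.of_forall fun n => Eventually.of_forall fun x _ => ?_
      rw [norm_neg, norm_mul, Real.norm_eq_abs, abs_two]
      gcongr
      refine (Complex.abs_re_le_norm _).trans ((norm_inner_le_norm _ _).trans ?_)
      gcongr <;> exact norm_cutOff_le n _
    · exact ContinuousOn.intervalIntegrable
        (((hv.norm.mul hF.norm).const_smul (2 : ℝ)).mono hsub)
    · refine Eventually.of_forall fun x _ => ?_
      exact (((Complex.continuous_re.tendsto _).comp
        ((tendsto_cutOff _).inner (tendsto_cutOff _))).const_mul 2).neg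
  exact ((hRlim.hasDerivWithinAt_integral ht).const_add _).congr hlim (hlim t ht)

/-- Stability: for a forcing term with `‖F‖ ≤ L (‖u‖ + ‖u_t‖) + δ`, the full energy
`‖u‖² + ‖u_t‖² + ‖(-Δ)^(s/2) u‖²` grows at most exponentially. -/
theorem IsForcedSolution.energy_le {F u : ℝ → L2Space d} (hT : 0 < T)
    (hu : IsForcedSolution s T F u) {L δ : ℝ} (hL : 0 ≤ L)
    (hF : ∀ t ∈ Icc 0 T, ‖F t‖ ≤ L * (‖u t‖ + ‖timeDeriv T u t‖) + δ) {t : ℝ} (ht : t ∈ Icc 0 T) :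
    ‖u t‖ ^ 2 + (‖timeDeriv T u t‖ ^ 2 + ‖fracLaplacianHalf s (u t)‖ ^ 2)
      ≤ gronwallBound (‖u 0‖ ^ 2 + (‖timeDeriv T u 0‖ ^ 2 + ‖fracLaplacianHalf s (u 0)‖ ^ 2))
          (3 * L + 2) (δ ^ 2) T := by
  let N : ℝ → ℝ := fun t =>
    ‖u t‖ ^ 2 + (‖timeDeriv T u t‖ ^ 2 + ‖fracLaplacianHalf s (u t)‖ ^ 2)
  let N' : ℝ → ℝ := fun t => 2 * (inner ℂ (u t) (timeDeriv T u t)).re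
    + -(2 * (inner ℂ (timeDeriv T u t) (F t)).re)
  have hN : ∀ τ ∈ Icc 0 T, HasDerivWithinAt N (N' τ) (Icc 0 T) τ := fun τ hτ =>
    (hasDerivWithinAt_norm_sq_L2 (hu.energySpace.hasDerivWithinAt hτ)).add
      (hu.hasDerivWithinAt_energy hT hτ)
  have hN0 : ∀ τ, 0 ≤ N τ := fun τ => by positivity
  have hbound : ∀ τ ∈ Ico 0 T, ‖N' τ‖ ≤ (3 * L + 2) * ‖N τ‖ + δ ^ 2 := by
    intro τ hτ
    have h1 : |(inner ℂ (u τ) (timeDeriv T u τ)).re| ≤ ‖u τ‖ * ‖timeDeriv T u τ‖ :=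
      (Complex.abs_re_le_norm _).trans (norm_inner_le_norm _ _)
    have h2 : |(inner ℂ (timeDeriv T u τ) (F τ)).re| ≤ ‖timeDeriv T u τ‖ *
        (L * (‖u τ‖ + ‖timeDeriv T u τ‖) + δ) :=
      (Complex.abs_re_le_norm _).trans ((norm_inner_le_norm _ _).trans
        (mul_le_mul_of_nonneg_left (hF τ (mem_Icc_of_Ico hτ)) (norm_nonneg _)))
    rw [Real.norm_eq_abs, Real.norm_eq_abs, abs_of_nonneg (hN0 τ)]
    have h3 : |N' τ| ≤ 2 * (‖u τ‖ * ‖timeDeriv T u τ‖) + 2 * (‖timeDeriv T u τ‖ *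
        (L * (‖u τ‖ + ‖timeDeriv T u τ‖) + δ)) := by
      refine (abs_add_le _ _).trans ?_
      rw [abs_neg, abs_mul, abs_mul, abs_two]
      gcongr
    refine h3.trans ?_
    simp only [N]
    set p := ‖u τ‖
    set q := ‖timeDeriv T u τ‖
    set r := ‖fracLaplacianHalf s (u τ)‖
    -- Young's inequality for the products `p q` and `q δ`
    nlinarith [mul_nonneg hL (sq_nonneg (p - q)), sq_nonneg (p - q), sq_nonneg (q - δ),
      mul_nonneg hL (sq_nonneg p), mul_nonneg hL (sq_nonneg r), sq_nonneg p, sq_nonneg r]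
  have h := norm_le_gronwallBound_of_norm_deriv_right_le (f := N) (f' := N')
    (fun τ hτ => (hN τ hτ).continuousWithinAt)
    (fun τ hτ => (hN τ (mem_Icc_of_Ico hτ)).mono_of_mem_nhdsWithin (Icc_mem_nhdsGE_of_mem hτ))
    (by rw [Real.norm_eq_abs, abs_of_nonneg (hN0 0)]) hbound t ht
  rw [Real.norm_eq_abs, abs_of_nonneg (hN0 t)] at h
  refine h.trans ?_
  rw [sub_zero]
  exact gronwallBound_mono (hN0 0) (sq_nonneg δ) (by positivity) ht.2

end Energy

/-! ### Existence of solutions -/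

section Existence

variable {d : ℕ} {s T : ℝ}

/-- The operator `sin(t (-Δ)^(s/2))`. -/
noncomputable def sinOp (s t : ℝ) : L2Space d →L[ℂ] L2Space d := specOp s fun x => Real.sin (t * x)

/-- The operator `cos(t (-Δ)^(s/2))`. -/
noncomputable def cosOp (s t : ℝ) : L2Space d →L[ℂ] L2Space d := specOp s fun x => Real.cos (t * x)

theorem memLp_sin (t : ℝ) : MemLp (fun ξ : EuclideanSpace ℝ (Fin d) =>
    (Real.sin (t * fracSymbol s ξ) : ℂ)) ∞ volume :=
  memLp_spec_mul Real.measurable_sin Real.abs_sin_le_one t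

theorem memLp_cos (t : ℝ) : MemLp (fun ξ : EuclideanSpace ℝ (Fin d) =>
    (Real.cos (t * fracSymbol s ξ) : ℂ)) ∞ volume :=
  memLp_spec_mul Real.measurable_cos Real.abs_cos_le_one t

theorem norm_sinOp_le (t : ℝ) (f : L2Space d) : ‖sinOp s t f‖ ≤ ‖f‖ :=
  (norm_fourierMult_le (memLp_sin t).1 (C := 1)
    (fun _ => (Complex.norm_real _).trans_le (Real.abs_sin_le_one _)) f).trans_eq (one_mul _)

theorem norm_cosOp_le (t : ℝ) (f : L2Space d) : ‖cosOp s t f‖ ≤ ‖f‖ :=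
  (norm_fourierMult_le (memLp_cos t).1 (C := 1)
    (fun _ => (Complex.norm_real _).trans_le (Real.abs_cos_le_one _)) f).trans_eq (one_mul _)

theorem inner_sinOp (t : ℝ) (f g : L2Space d) :
    inner ℂ (sinOp s t f) g = inner ℂ f (sinOp s t g) :=
  inner_fourierMult_ofReal (memLp_sin t) f g

theorem inner_cosOp (t : ℝ) (f g : L2Space d) :
    inner ℂ (cosOp s t f) g = inner ℂ f (cosOp s t g) :=
  inner_fourierMult_ofReal (memLp_cos t) f g

theorem sinOp_cosOp (t : ℝ) (f : L2Space d) :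
    sinOp s t (cosOp s t f) = cosOp s t (sinOp s t f) :=
  (fourierMult_fourierMult (memLp_sin t) (memLp_cos t) ((memLp_sin t).mul (memLp_cos t))
    (fun _ => mul_comm _ _) f).trans
  (fourierMult_fourierMult (memLp_cos t) (memLp_sin t) ((memLp_sin t).mul (memLp_cos t))
    (fun _ => rfl) f).symm

theorem sinOp_sq_add_cosOp_sq (t : ℝ) (f : L2Space d) :
    sinOp s t (sinOp s t f) + cosOp s t (cosOp s t f) = f := by
  refine fourier_injective_L2 (Lp.ext ?_)
  rw [FourierTransform.fourier_add]
  filter_upwards [coeFn_fourier_fourierMult (memLp_sin (s := s) t) (sinOp s t f),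
    coeFn_fourier_fourierMult (memLp_sin (s := s) t) f,
    coeFn_fourier_fourierMult (memLp_cos (s := s) t) (cosOp s t f),
    coeFn_fourier_fourierMult (memLp_cos (s := s) t) f,
    Lp.coeFn_add (𝓕 (sinOp s t (sinOp s t f)) : L2Space d) (𝓕 (cosOp s t (cosOp s t f)))]
    with x h1 h2 h3 h4 h5
  have h1' : (𝓕 (sinOp s t (sinOp s t f)) : L2Space d) x = _ := h1
  have h2' : (𝓕 (sinOp s t f) : L2Space d) x = _ := h2
  have h3' : (𝓕 (cosOp s t (cosOp s t f)) : L2Space d) x = _ := h3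
  have h4' : (𝓕 (cosOp s t f) : L2Space d) x = _ := h4
  rw [h5, Pi.add_apply, h1', h2', h3', h4', ← mul_assoc, ← mul_assoc, ← add_mul]
  have : (Real.sin (t * fracSymbol s x) : ℂ) * Real.sin (t * fracSymbol s x)
      + Real.cos (t * fracSymbol s x) * Real.cos (t * fracSymbol s x) = 1 := by
    rw [← Complex.ofReal_mul, ← Complex.ofReal_mul, ← Complex.ofReal_add, ← sq, ← sq,
      Real.sin_sq_add_cos_sq, Complex.ofReal_one]
  rw [this, one_mul]

theorem sinOp_zero (f : L2Space d) : sinOp s 0 f = 0 := by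
  refine fourier_injective_L2 (Lp.ext ?_)
  rw [show (𝓕 (0 : L2Space d) : L2Space d) = 0 from map_zero (Lp.fourierTransformₗᵢ _ ℂ)]
  filter_upwards [coeFn_fourier_fourierMult (memLp_sin (s := s) 0) f, Lp.coeFn_zero ℂ 2 volume]
    with x h1 h2
  rw [h2]
  refine h1.trans ?_
  simp

theorem cosOp_zero (f : L2Space d) : cosOp s 0 f = f := by
  have := fourierMult_one f
  simpa [cosOp, specOp] using this

theorem continuous_sinOp : Continuous fun p : ℝ × L2Space d => sinOp s p.1 p.2 :=
  continuous_prod_of_continuous_lipschitzWith' _ 1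
    (fun t => LipschitzWith.of_dist_le_mul fun f g => by
      rw [dist_eq_norm, dist_eq_norm, NNReal.coe_one, one_mul]
      exact (congrArg norm (map_sub (sinOp s t) f g).symm).trans_le (norm_sinOp_le t _))
    (fun f => continuous_specOp Real.continuous_sin Real.abs_sin_le_one f)

theorem continuous_cosOp : Continuous fun p : ℝ × L2Space d => cosOp s p.1 p.2 :=
  continuous_prod_of_continuous_lipschitzWith' _ 1
    (fun t => LipschitzWith.of_dist_le_mul fun f g => by
      rw [dist_eq_norm, dist_eq_norm, NNReal.coe_one, one_mul]
      exact (congrArg norm (map_sub (cosOp s t) f g).symm).trans_le (norm_cosOp_le t _))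
    (fun f => continuous_specOp Real.continuous_cos Real.abs_cos_le_one f)

theorem hasDerivAt_sinOp {f : L2Space d} (hf : f ∈ sobolevHs d s) (t : ℝ) :
    HasDerivAt (fun t => sinOp s t f) (cosOp s t (fracLaplacianHalf s f)) t :=
  hasDerivAt_specOp Real.abs_sin_le_one Real.hasDerivAt_sin Real.measurable_cos
    Real.abs_cos_le_one hf t

theorem hasDerivAt_cosOp {f : L2Space d} (hf : f ∈ sobolevHs d s) (t : ℝ) :
    HasDerivAt (fun t => cosOp s t f) (-sinOp s t (fracLaplacianHalf s f)) t := by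
  refine (hasDerivAt_specOp (g := Real.cos) (g' := fun x => -Real.sin x) Real.abs_cos_le_one
    Real.hasDerivAt_cos Real.measurable_sin.neg (fun x => by simpa using Real.abs_sin_le_one x)
    hf t).congr_deriv ?_
  refine fourier_injective_L2 (Lp.ext ?_)
  rw [show (𝓕 (-sinOp s t (fracLaplacianHalf s f)) : L2Space d)
    = -𝓕 (sinOp s t (fracLaplacianHalf s f)) from map_neg (Lp.fourierTransformₗᵢ _ ℂ) _]
  filter_upwards [coeFn_fourier_fourierMult (memLp_sin (s := s) t) (fracLaplacianHalf s f),
    coeFn_fourier_fourierMult (memLp_spec_mul (s := s) (g := fun x => -Real.sin x)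
      Real.measurable_sin.neg (fun x => by simpa using Real.abs_sin_le_one x) t)
      (fracLaplacianHalf s f),
    Lp.coeFn_neg (𝓕 (sinOp s t (fracLaplacianHalf s f)) : L2Space d)] with x h1 h2 h3
  have h1' : (𝓕 (sinOp s t (fracLaplacianHalf s f)) : L2Space d) x = _ := h1
  rw [h3, Pi.neg_apply, h1']
  refine h2.trans ?_
  simp

/-- The velocity `-sin(tΛ) w + cos(tΛ) p` recovered from the profiles `y = (u, w, p)`, where
`Λ = (-Δ)^(s/2)`. -/
noncomputable def profileVelocity (s t : ℝ) (y : L2Space d × L2Space d × L2Space d) : L2Space d :=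
  cosOp s t y.2.2 - sinOp s t y.2.1

/-- The vector field of the equation `u_tt + (-Δ)^s u + A u + B u_t = 0` in the interaction picture.
The free evolution is undone in the variables `(Λ u, u_t)`, where `Λ = (-Δ)^(s/2)`, so that only
bounded operators remain. -/
noncomputable def interactionField (s : ℝ) (A B : L2Space d →L[ℂ] L2Space d) (t : ℝ)
    (y : L2Space d × L2Space d × L2Space d) : L2Space d × L2Space d × L2Space d :=
  (profileVelocity s t y, sinOp s t (A y.1 + B (profileVelocity s t y)),
    -cosOp s t (A y.1 + B (profileVelocity s t y)))

theorem continuous_profileVelocity : Continuous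
    fun p : ℝ × L2Space d × L2Space d × L2Space d => profileVelocity s p.1 p.2 := by
  have h1 : Continuous fun p : ℝ × L2Space d × L2Space d × L2Space d => (p.1, p.2.2.2) := by
    fun_prop
  have h2 : Continuous fun p : ℝ × L2Space d × L2Space d × L2Space d => (p.1, p.2.2.1) := by
    fun_prop
  have h3 := continuous_cosOp (s := s).comp h1
  have h4 := continuous_sinOp (s := s).comp h2
  exact h3.sub h4

theorem continuous_interactionField (A B : L2Space d →L[ℂ] L2Space d) :
    Continuous (Function.uncurry (interactionField s A B)) := by
  have hv := continuous_profileVelocity (d := d) (s := s)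
  have hF : Continuous fun p : ℝ × L2Space d × L2Space d × L2Space d =>
      (p.1, A p.2.1 + B (profileVelocity s p.1 p.2)) :=
    continuous_fst.prodMk ((A.continuous.comp (by fun_prop)).add (B.continuous.comp hv))
  exact hv.prodMk ((continuous_sinOp.comp hF).prodMk (continuous_cosOp.comp hF).neg)

theorem profileVelocity_sub (t : ℝ) (y z : L2Space d × L2Space d × L2Space d) :
    profileVelocity s t y - profileVelocity s t z = profileVelocity s t (y - z) := by
  simp only [profileVelocity, Prod.snd_sub, Prod.fst_sub, map_sub]
  abel

theorem interactionField_sub (A B : L2Space d →L[ℂ] L2Space d) (t : ℝ)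
    (y z : L2Space d × L2Space d × L2Space d) :
    interactionField s A B t y - interactionField s A B t z = interactionField s A B t (y - z) := by
  have h : A y.1 + B (profileVelocity s t y) - (A z.1 + B (profileVelocity s t z))
      = A (y - z).1 + B (profileVelocity s t (y - z)) := by
    rw [← profileVelocity_sub, Prod.fst_sub, map_sub, map_sub]
    abel
  unfold interactionField
  rw [← h, Prod.mk_sub_mk, Prod.mk_sub_mk, profileVelocity_sub, map_sub, map_sub]
  congr 2
  abel

theorem norm_profileVelocity_le (t : ℝ) (y : L2Space d × L2Space d × L2Space d) :
    ‖profileVelocity s t y‖ ≤ 2 * ‖y‖ := by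
  have h1 : ‖y.2.1‖ ≤ ‖y‖ := (norm_fst_le y.2).trans (norm_snd_le y)
  have h2 : ‖y.2.2‖ ≤ ‖y‖ := (norm_snd_le y.2).trans (norm_snd_le y)
  have h3 := norm_sinOp_le (s := s) t y.2.1
  have h4 := norm_cosOp_le (s := s) t y.2.2
  have := norm_sub_le (cosOp s t y.2.2) (sinOp s t y.2.1)
  unfold profileVelocity
  linarith

theorem norm_interactionField_le (A B : L2Space d →L[ℂ] L2Space d) (t : ℝ)
    (y : L2Space d × L2Space d × L2Space d) :
    ‖interactionField s A B t y‖ ≤ (2 + ‖A‖ + 2 * ‖B‖) * ‖y‖ := by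
  have hv := norm_profileVelocity_le (s := s) t y
  have hF : ‖A y.1 + B (profileVelocity s t y)‖ ≤ (‖A‖ + 2 * ‖B‖) * ‖y‖ := by
    refine (norm_add_le _ _).trans ?_
    have h1 : ‖A y.1‖ ≤ ‖A‖ * ‖y‖ := A.le_opNorm_of_le (norm_fst_le y)
    have h2 : ‖B (profileVelocity s t y)‖ ≤ ‖B‖ * (2 * ‖y‖) := B.le_opNorm_of_le hv
    linarith
  have h0 : 0 ≤ (‖A‖ + 2 * ‖B‖) * ‖y‖ := by positivity
  have hy := norm_nonneg y
  refine norm_prod_le_iff.2 ⟨?_, norm_prod_le_iff.2 ⟨?_, ?_⟩⟩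
  · exact hv.trans (by linarith)
  · exact (norm_sinOp_le t _).trans (by linarith)
  · refine (norm_neg _).trans_le ((norm_cosOp_le t _).trans (by linarith))

/-- If the profiles satisfy `w' = sin(tΛ) F`, `p' = -cos(tΛ) F`, where `Λ = (-Δ)^(s/2)`, then
`W = cos(tΛ) w + sin(tΛ) p` and `P = cos(tΛ) p - sin(tΛ) w` satisfy `W' = Λ P` weakly. In the
product rule all derivatives of the propagators fall on the test function `φ ∈ H^s`. -/
theorem hasDerivWithinAt_inner_profile_left {φ F : L2Space d} (hφ : φ ∈ sobolevHs d s)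
    {w p : ℝ → L2Space d} {S : Set ℝ} {t : ℝ} (hw : HasDerivWithinAt w (sinOp s t F) S t)
    (hp : HasDerivWithinAt p (-cosOp s t F) S t) :
    HasDerivWithinAt (fun τ => inner ℂ φ (cosOp s τ (w τ) + sinOp s τ (p τ)))
      (inner ℂ (fracLaplacianHalf s φ) (cosOp s t (p t) - sinOp s t (w t))) S t := by
  have h := ((hasDerivAt_cosOp hφ t).hasDerivWithinAt.inner ℂ hw).add
    ((hasDerivAt_sinOp hφ t).hasDerivWithinAt.inner ℂ hp)
  have he : ∀ τ, inner ℂ φ (cosOp s τ (w τ) + sinOp s τ (p τ))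
      = inner ℂ (cosOp s τ φ) (w τ) + inner ℂ (sinOp s τ φ) (p τ) := fun τ => by
    rw [inner_add_right, inner_cosOp, inner_sinOp]
  refine (h.congr (fun τ _ => he τ) (he t)).congr_deriv ?_
  rw [inner_neg_left, inner_neg_right, inner_sub_right, inner_cosOp, inner_sinOp, inner_cosOp,
    inner_sinOp, sinOp_cosOp]
  ring

/-- In the situation of `hasDerivWithinAt_inner_profile_left`, `P' = -(Λ W + F)` weakly. -/
theorem hasDerivWithinAt_inner_profile_right {φ F : L2Space d} (hφ : φ ∈ sobolevHs d s)
    {w p : ℝ → L2Space d} {S : Set ℝ} {t : ℝ} (hw : HasDerivWithinAt w (sinOp s t F) S t)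
    (hp : HasDerivWithinAt p (-cosOp s t F) S t) :
    HasDerivWithinAt (fun τ => inner ℂ φ (cosOp s τ (p τ) - sinOp s τ (w τ)))
      (-(inner ℂ (fracLaplacianHalf s φ) (cosOp s t (w t) + sinOp s t (p t)) + inner ℂ φ F))
      S t := by
  have h := ((hasDerivAt_cosOp hφ t).hasDerivWithinAt.inner ℂ hp).sub
    ((hasDerivAt_sinOp hφ t).hasDerivWithinAt.inner ℂ hw)
  have he : ∀ τ, inner ℂ φ (cosOp s τ (p τ) - sinOp s τ (w τ))
      = inner ℂ (cosOp s τ φ) (p τ) - inner ℂ (sinOp s τ φ) (w τ) := fun τ => by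
    rw [inner_sub_right, inner_cosOp, inner_sinOp]
  refine (h.congr (fun τ _ => he τ) (he t)).congr_deriv ?_
  have hF : inner ℂ φ F = inner ℂ φ (sinOp s t (sinOp s t F))
      + inner ℂ φ (cosOp s t (cosOp s t F)) := by
    rw [← inner_add_right, sinOp_sq_add_cosOp_sq]
  rw [hF, inner_neg_left, inner_neg_right, inner_add_right, inner_cosOp, inner_sinOp, inner_cosOp,
    inner_sinOp]
  ring

/-- The weak first-order system `u' = p`, `w' = Λ p`, `p' = -(Λ w + A u + B p)` with
`w(0) = Λ u(0)`, where `Λ = (-Δ)^(s/2)`, forces `w = Λ u`, and then `u` solves the second-order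
equation. -/
theorem IsForcedSolution.of_firstOrder (hT : 0 < T) (A B : L2Space d →L[ℂ] L2Space d)
    {u p w : ℝ → L2Space d} (hu : ∀ t ∈ Icc 0 T, HasDerivWithinAt u (p t) (Icc 0 T) t)
    (hpc : ContinuousOn p (Icc 0 T)) (hwc : ContinuousOn w (Icc 0 T))
    (hu0 : u 0 ∈ sobolevHs d s) (hw0 : w 0 = fracLaplacianHalf s (u 0))
    (hφw : ∀ φ ∈ sobolevHs d s, ∀ t ∈ Icc 0 T, HasDerivWithinAt (fun τ => inner ℂ φ (w τ))
      (inner ℂ (fracLaplacianHalf s φ) (p t)) (Icc 0 T) t)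
    (hφp : ∀ φ ∈ sobolevHs d s, ∀ t ∈ Icc 0 T, HasDerivWithinAt (fun τ => inner ℂ φ (p τ))
      (-(inner ℂ (fracLaplacianHalf s φ) (w t) + inner ℂ φ (A (u t) + B (p t)))) (Icc 0 T) t) :
    IsForcedSolution s T (fun t => A (u t) + B (timeDeriv T u t)) u := by
  have huc : ContinuousOn u (Icc 0 T) := fun t ht => (hu t ht).continuousWithinAt
  -- both sides have the same weak derivative and the same initial value
  have hcut : ∀ t ∈ Icc 0 T, ∀ n, cutOff s n (w t) = cutLaplacian s n (u t) := by
    intro t ht n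
    refine ext_inner_left ℂ fun φ => ?_
    rw [← inner_cutOff, ← inner_cutLaplacian]
    refine eq_of_hasDerivWithinAt_eq (f := fun τ => inner ℂ (cutOff s n φ) (w τ))
      (g := fun τ => inner ℂ (cutLaplacian s n φ) (u τ))
      (f' := fun τ => inner ℂ (cutLaplacian s n φ) (p τ)) (fun t ht => ?_) (fun t ht => ?_) ?_ t ht
    · rw [← fracLaplacianHalf_cutOff]
      exact hφw _ (cutOff_mem_sobolevHs n φ) t ht
    · have h := (hasDerivWithinAt_const t (Icc 0 T) (cutLaplacian s n φ)).inner ℂ (hu t ht)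
      rwa [inner_zero_left, add_zero] at h
    · rw [hw0, inner_cutOff, inner_cutLaplacian, cutLaplacian_eq_cutOff n hu0]
  have hae := fun t ht => fourier_ae_eq_of_cut (hcut t ht)
  have hmem : ∀ t ∈ Icc 0 T, u t ∈ sobolevHs d s := fun t ht =>
    mem_sobolevHs_of_fourier_ae_eq (hae t ht)
  have hLu : ∀ t ∈ Icc 0 T, fracLaplacianHalf s (u t) = w t := fun t ht =>
    fracLaplacianHalf_eq_of_fourier_ae_eq (hae t ht)
  have hvel : ∀ t ∈ Icc 0 T, timeDeriv T u t = p t := fun t ht => timeDeriv_eq hT ht (hu t ht)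
  refine ⟨.of_hasDerivWithinAt hT hu hpc hmem hLu hwc, ?_, fun φ hφ t ht => ?_⟩
  · exact ((A.continuous.comp_continuousOn huc).add (B.continuous.comp_continuousOn hpc)).congr
      fun t ht => by rw [hvel t ht]; rfl
  · rw [hLu t ht, hvel t ht]
    exact (hφp φ hφ t ht).congr (fun τ hτ => by rw [hvel τ hτ]) (by rw [hvel t ht])

/-- The Cauchy problem for `u_tt + (-Δ)^s u + A u + B u_t = 0` with bounded operators `A`, `B` on
`L²` has a solution with data in `H^s × L²`. -/
theorem exists_forcedSolution (hT : 0 < T) (A B : L2Space d →L[ℂ] L2Space d) {u₀ : L2Space d}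
    (hu₀ : u₀ ∈ sobolevHs d s) (u₁ : L2Space d) :
    ∃ u, IsForcedSolution s T (fun t => A (u t) + B (timeDeriv T u t)) u ∧ u 0 = u₀ ∧
      timeDeriv T u 0 = u₁ := by
  obtain ⟨y, hy0, hy⟩ := exists_solution_of_lipschitz (continuous_interactionField (s := s) A B)
    (M := 2 + ‖A‖ + 2 * ‖B‖) (by positivity)
    (fun t y z => by rw [interactionField_sub]; exact norm_interactionField_le A B t _)
    T (u₀, fracLaplacianHalf s u₀, u₁)
  have hyc : ContinuousOn y (Icc 0 T) := fun t ht => (hy t ht).continuousWithinAt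
  let u : ℝ → L2Space d := fun t => (y t).1
  let p : ℝ → L2Space d := fun t => profileVelocity s t (y t)
  let w : ℝ → L2Space d := fun t => cosOp s t (y t).2.1 + sinOp s t (y t).2.2
  let F : ℝ → L2Space d := fun t => A (u t) + B (p t)
  have hu : ∀ t ∈ Icc 0 T, HasDerivWithinAt u (p t) (Icc 0 T) t := fun t ht =>
    (ContinuousLinearMap.fst ℝ (L2Space d) (L2Space d × L2Space d)).hasFDerivAt
      |>.comp_hasDerivWithinAt t (hy t ht)
  have hw : ∀ t ∈ Icc 0 T, HasDerivWithinAt (fun t => (y t).2.1) (sinOp s t (F t)) (Icc 0 T) t :=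
    fun t ht => (ContinuousLinearMap.fst ℝ (L2Space d) (L2Space d) ∘L
      ContinuousLinearMap.snd ℝ (L2Space d) (L2Space d × L2Space d)).hasFDerivAt
      |>.comp_hasDerivWithinAt t (hy t ht)
  have hp : ∀ t ∈ Icc 0 T, HasDerivWithinAt (fun t => (y t).2.2) (-cosOp s t (F t)) (Icc 0 T) t :=
    fun t ht => (ContinuousLinearMap.snd ℝ (L2Space d) (L2Space d) ∘L
      ContinuousLinearMap.snd ℝ (L2Space d) (L2Space d × L2Space d)).hasFDerivAt
      |>.comp_hasDerivWithinAt t (hy t ht)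
  have hpc : ContinuousOn p (Icc 0 T) := by
    have h : ContinuousOn (fun t => (t, y t)) (Icc 0 T) := continuousOn_id.prodMk hyc
    have h' := (continuous_profileVelocity (d := d) (s := s)).comp_continuousOn h
    exact h'
  have hwc : ContinuousOn w (Icc 0 T) := by
    have h1 : ContinuousOn (fun t => (t, (y t).2.1)) (Icc 0 T) := continuousOn_id.prodMk hyc.snd.fst
    have h2 : ContinuousOn (fun t => (t, (y t).2.2)) (Icc 0 T) := continuousOn_id.prodMk hyc.snd.snd
    have h3 := (continuous_cosOp (d := d) (s := s)).comp_continuousOn h1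
    have h4 := (continuous_sinOp (d := d) (s := s)).comp_continuousOn h2
    exact h3.add h4
  have hφw : ∀ φ ∈ sobolevHs d s, ∀ t ∈ Icc 0 T, HasDerivWithinAt (fun τ => inner ℂ φ (w τ))
      (inner ℂ (fracLaplacianHalf s φ) (p t)) (Icc 0 T) t := fun φ hφ t ht =>
    hasDerivWithinAt_inner_profile_left hφ (hw t ht) (hp t ht)
  have hφp : ∀ φ ∈ sobolevHs d s, ∀ t ∈ Icc 0 T, HasDerivWithinAt (fun τ => inner ℂ φ (p τ))
      (-(inner ℂ (fracLaplacianHalf s φ) (w t) + inner ℂ φ (F t))) (Icc 0 T) t := fun φ hφ t ht =>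
    hasDerivWithinAt_inner_profile_right hφ (hw t ht) (hp t ht)
  have hu0 : u 0 = u₀ := by simp [u, hy0]
  have hp0 : p 0 = u₁ := by simp [p, profileVelocity, hy0, cosOp_zero, sinOp_zero]
  have hw0 : w 0 = fracLaplacianHalf s u₀ := by simp [w, hy0, cosOp_zero, sinOp_zero]
  exact ⟨u, .of_firstOrder hT A B hu hpc hwc (hu0 ▸ hu₀) (by rw [hw0, hu0]) hφw hφp, hu0,
    (timeDeriv_eq hT ⟨le_rfl, hT.le⟩ (hu 0 ⟨le_rfl, hT.le⟩)).trans hp0⟩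

end Existence

/-! ### Mollification as a Fourier multiplier -/

section Mollification

variable {d : ℕ}

local notation "𝔼" => EuclideanSpace ℝ (Fin d)

theorem integral_rescale {F : Type*} [NormedAddCommGroup F] [NormedSpace ℝ F] {ε : ℝ} (hε : 0 < ε)
    (h : 𝔼 → F) : ∫ x, (ε ^ d)⁻¹ • h (ε⁻¹ • x) = ∫ x, h x := by
  rw [integral_smul, Measure.integral_comp_inv_smul_of_nonneg _ _ hε.le, finrank_euclideanSpace_fin,
    smul_smul, inv_mul_cancel₀ (pow_pos hε d).ne', one_smul]

theorem isFriedrichsMollifier_mollifyingNet {ψ : 𝔼 → ℝ} (hψ : IsFriedrichsMollifier ψ) {ε : ℝ}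
    (hε : 0 < ε) : IsFriedrichsMollifier (mollifyingNet ψ ε) where
  contDiff := contDiff_const.mul (hψ.contDiff.comp (contDiff_const_smul ε⁻¹))
  hasCompactSupport := (hψ.hasCompactSupport.comp_smul (inv_ne_zero hε.ne')).mul_left
  nonneg x := mul_nonneg (by positivity) (hψ.nonneg _)
  integral_eq_one := (integral_rescale hε ψ).trans hψ.integral_eq_one

theorem IsFriedrichsMollifier.continuous {η : 𝔼 → ℝ} (hη : IsFriedrichsMollifier η) :
    Continuous η := hη.contDiff.continuous

theorem IsFriedrichsMollifier.integrable {η : 𝔼 → ℝ} (hη : IsFriedrichsMollifier η) :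
    Integrable η := hη.continuous.integrable_of_hasCompactSupport hη.hasCompactSupport

/-- A Friedrichs mollifier as a complex-valued Schwartz function. -/
noncomputable def IsFriedrichsMollifier.toSchwartz {η : 𝔼 → ℝ} (hη : IsFriedrichsMollifier η) :
    SchwartzMap 𝔼 ℂ :=
  HasCompactSupport.toSchwartzMap (f := fun x => (η x : ℂ))
    (hη.hasCompactSupport.comp_left Complex.ofReal_zero)
    (Complex.ofRealCLM.contDiff.comp hη.contDiff)

theorem IsFriedrichsMollifier.toSchwartz_apply {η : 𝔼 → ℝ} (hη : IsFriedrichsMollifier η) (x : 𝔼) :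
    hη.toSchwartz x = (η x : ℂ) := rfl

theorem IsFriedrichsMollifier.fourier_toSchwartz {η : 𝔼 → ℝ} (hη : IsFriedrichsMollifier η)
    (ξ : 𝔼) : 𝓕 hη.toSchwartz ξ = 𝓕 (fun x => (η x : ℂ)) ξ := rfl

theorem IsFriedrichsMollifier.continuous_fourier {η : 𝔼 → ℝ} (hη : IsFriedrichsMollifier η) :
    Continuous (𝓕 (fun x => (η x : ℂ)) : 𝔼 → ℂ) := (𝓕 hη.toSchwartz).continuous

theorem IsFriedrichsMollifier.norm_fourier_le {η : 𝔼 → ℝ} (hη : IsFriedrichsMollifier η) (ξ : 𝔼) :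
    ‖𝓕 (fun x => (η x : ℂ)) ξ‖ ≤ 1 := by
  rw [Real.fourier_eq]
  refine (norm_integral_le_integral_norm _).trans ?_
  simp only [Circle.norm_smul, Complex.norm_real, Real.norm_eq_abs, abs_of_nonneg (hη.nonneg _)]
  exact hη.integral_eq_one.le

theorem IsFriedrichsMollifier.fourier_zero {η : 𝔼 → ℝ} (hη : IsFriedrichsMollifier η) :
    𝓕 (fun x => (η x : ℂ)) (0 : 𝔼) = 1 := by
  simp [Real.fourier_eq, integral_complex_ofReal, hη.integral_eq_one]

theorem fourier_mollifyingNet (ψ : 𝔼 → ℝ) {ε : ℝ} (hε : 0 < ε) (ξ : 𝔼) :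
    𝓕 (fun x => (mollifyingNet ψ ε x : ℂ)) ξ = 𝓕 (fun x => (ψ x : ℂ)) (ε • ξ) := by
  rw [Real.fourier_eq, Real.fourier_eq, ← integral_rescale hε
    (fun x => Real.fourierChar (-inner ℝ x (ε • ξ)) • (ψ x : ℂ))]
  refine integral_congr_ae (Eventually.of_forall fun x => ?_)
  simp only [mollifyingNet, real_inner_smul_left, real_inner_smul_right]
  rw [mul_inv_cancel_left₀ hε.ne', smul_comm, Complex.ofReal_mul, Complex.real_smul]

/-- The kernel `t ↦ η(x - t)` of the convolution with `η` at the point `x`, in `L²`. -/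
theorem IsFriedrichsMollifier.memLp_kernel {η : 𝔼 → ℝ} (hη : IsFriedrichsMollifier η) (x : 𝔼) :
    MemLp (fun t => (η (x - t) : ℂ)) 2 volume := by
  have hc : Continuous fun t => (η (x - t) : ℂ) :=
    Complex.continuous_ofReal.comp (hη.continuous.comp (continuous_sub_left x))
  refine hc.memLp_of_hasCompactSupport ?_
  exact (hη.hasCompactSupport.comp_homeomorph (Homeomorph.subLeft x)).comp_left
    (g := fun r : ℝ => (r : ℂ)) Complex.ofReal_zero

theorem IsFriedrichsMollifier.convolution_eq_inner {η : 𝔼 → ℝ} (hη : IsFriedrichsMollifier η)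
    (f : L2Space d) (x : 𝔼) :
    convolution η f (ContinuousLinearMap.lsmul ℝ ℝ) volume x
      = inner ℂ ((hη.memLp_kernel x).toLp _) f := by
  rw [convolution_eq_swap, L2.inner_def]
  refine integral_congr_ae ?_
  filter_upwards [(hη.memLp_kernel x).coeFn_toLp] with t ht
  rw [ht, RCLike.inner_apply, Complex.conj_ofReal, ContinuousLinearMap.lsmul_apply,
    Complex.real_smul, mul_comm]

theorem IsFriedrichsMollifier.memLp_fourier {η : 𝔼 → ℝ} (hη : IsFriedrichsMollifier η) :
    MemLp (𝓕 (fun x => (η x : ℂ)) : 𝔼 → ℂ) ∞ volume :=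
  .top_of_norm_le hη.continuous_fourier.aestronglyMeasurable hη.norm_fourier_le

theorem IsFriedrichsMollifier.fourierMult_schwartz {η : 𝔼 → ℝ} (hη : IsFriedrichsMollifier η)
    (f : SchwartzMap 𝔼 ℂ) :
    fourierMult (𝓕 (fun x => (η x : ℂ))) (f.toLp 2)
      =ᵐ[volume] convolution η (f.toLp 2) (ContinuousLinearMap.lsmul ℝ ℝ) volume := by
  let g : SchwartzMap 𝔼 ℂ := SchwartzMap.convolution (ContinuousLinearMap.mul ℂ ℂ) hη.toSchwartz f
  have hg : fourierMult (𝓕 (fun x => (η x : ℂ))) (f.toLp 2) = (g.toLp 2 : L2Space d) := by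
    refine fourier_injective_L2 (Lp.ext ?_)
    rw [SchwartzMap.toLp_fourier_eq]
    filter_upwards [coeFn_fourier_fourierMult hη.memLp_fourier (f.toLp 2),
      (𝓕 g).coeFn_toLp 2 volume, (𝓕 f).coeFn_toLp 2 volume] with x h1 h2 h3
    rw [h1, h2, SchwartzMap.toLp_fourier_eq, h3, SchwartzMap.fourier_convolution,
      SchwartzMap.pairing_apply_apply, ContinuousLinearMap.mul_apply', hη.fourier_toSchwartz]
  rw [hg]
  filter_upwards [g.coeFn_toLp 2 volume] with x h1
  rw [h1, SchwartzMap.convolution_apply, convolution_eq_swap, convolution_eq_swap]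
  refine integral_congr_ae ?_
  filter_upwards [f.coeFn_toLp 2 volume] with t h2
  rw [h2, ContinuousLinearMap.lsmul_apply, ContinuousLinearMap.mul_apply', hη.toSchwartz_apply,
    Complex.real_smul]

/-- On `L²`, convolution with a Friedrichs mollifier is a Fourier multiplier. For Schwartz functions
this is the convolution theorem; in the limit, one side converges in `L²` and the other one
pointwise, by the Cauchy-Schwarz inequality. -/
theorem IsFriedrichsMollifier.fourierMult_ae_eq {η : 𝔼 → ℝ} (hη : IsFriedrichsMollifier η)
    (f : L2Space d) :
    fourierMult (𝓕 (fun x => (η x : ℂ))) f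
      =ᵐ[volume] convolution η f (ContinuousLinearMap.lsmul ℝ ℝ) volume := by
  have hdense : DenseRange (SchwartzMap.toLpCLM ℂ (E := 𝔼) ℂ 2 volume) :=
    SchwartzMap.denseRange_toLpCLM ENNReal.ofNat_ne_top
  obtain ⟨g, hg, hgf⟩ := mem_closure_iff_seq_limit.1 (hdense f)
  choose φ hφ using hg
  have hφ' : ∀ n, g n = (φ n).toLp 2 volume := fun n => (hφ n).symm
  have hlim := ((fourierMult (𝓕 (fun x => (η x : ℂ)))).continuous.tendsto f).comp hgf
  obtain ⟨ns, hns, hae⟩ := (tendstoInMeasure_of_tendsto_Lp hlim).exists_seq_tendsto_ae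
  filter_upwards [hae, ae_all_iff.2 fun n => hη.fourierMult_schwartz (φ n)] with x h1 h2
  refine tendsto_nhds_unique h1 ?_
  have h3 : ∀ i, (fourierMult (𝓕 (fun x => (η x : ℂ))) (g (ns i)) : L2Space d) x
      = inner ℂ ((hη.memLp_kernel x).toLp _) (g (ns i)) := fun i => by
    rw [hφ', h2, hη.convolution_eq_inner]
  simp only [Function.comp_apply, h3]
  rw [hη.convolution_eq_inner]
  exact tendsto_const_nhds.inner (hgf.comp hns.tendsto_atTop)

/-- The operator of convolution with `ψ_ε`, given by its symbol `ψ̂(ε ξ)`. -/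
noncomputable def mollify (ψ : 𝔼 → ℝ) (ε : ℝ) : L2Space d →L[ℂ] L2Space d :=
  fourierMult fun ξ => 𝓕 (fun x => (ψ x : ℂ)) (ε • ξ)

theorem IsFriedrichsMollifier.memLp_mollify {ψ : 𝔼 → ℝ} (hψ : IsFriedrichsMollifier ψ) (ε : ℝ) :
    MemLp (fun ξ : 𝔼 => 𝓕 (fun x => (ψ x : ℂ)) (ε • ξ)) ∞ volume :=
  .top_of_norm_le (hψ.continuous_fourier.comp (continuous_const_smul ε)).aestronglyMeasurable
    fun _ => hψ.norm_fourier_le _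

theorem IsFriedrichsMollifier.mollify_ae_eq {ψ : 𝔼 → ℝ} (hψ : IsFriedrichsMollifier ψ) {ε : ℝ}
    (hε : 0 < ε) (f : L2Space d) : mollify ψ ε f =ᵐ[volume] regularise ψ f ε := by
  have h := (isFriedrichsMollifier_mollifyingNet hψ hε).fourierMult_ae_eq f
  rwa [show (𝓕 (fun x => (mollifyingNet ψ ε x : ℂ)) : 𝔼 → ℂ)
    = fun ξ => 𝓕 (fun x => (ψ x : ℂ)) (ε • ξ) from funext (fourier_mollifyingNet ψ hε)] at h

theorem IsFriedrichsMollifier.norm_mollify_le {ψ : 𝔼 → ℝ} (hψ : IsFriedrichsMollifier ψ) (ε : ℝ)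
    (f : L2Space d) : ‖mollify ψ ε f‖ ≤ ‖f‖ :=
  (norm_fourierMult_le (hψ.memLp_mollify ε).1 (fun _ => hψ.norm_fourier_le _) f).trans_eq
    (one_mul _)

theorem IsFriedrichsMollifier.tendsto_mollify {ψ : 𝔼 → ℝ} (hψ : IsFriedrichsMollifier ψ)
    (f : L2Space d) : Tendsto (fun ε => mollify ψ ε f) (𝓝[>] 0) (𝓝 f) := by
  have h := tendsto_fourierMult (l := 𝓝[>] (0 : ℝ)) (g₀ := fun _ => 1) (C := 1)
    (fun ε => (hψ.memLp_mollify ε).1) aestronglyMeasurable_const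
    (fun ε x => hψ.norm_fourier_le _) (by simp) (fun x => ?_) f
  · rwa [fourierMult_one] at h
  · have hc : Continuous fun ε : ℝ => 𝓕 (fun x => (ψ x : ℂ)) (ε • x) :=
      hψ.continuous_fourier.comp (by fun_prop)
    have := hc.tendsto 0
    rw [zero_smul, hψ.fourier_zero] at this
    exact this.mono_left nhdsWithin_le_nhds

theorem ae_sub_left {p : 𝔼 → Prop} (h : ∀ᵐ x, p x) (x : 𝔼) : ∀ᵐ t, p (x - t) :=
  (Measure.measurePreserving_sub_left volume x).quasiMeasurePreserving.ae h

theorem IsFriedrichsMollifier.regularise_nonneg {ψ : 𝔼 → ℝ} (hψ : IsFriedrichsMollifier ψ) {ε : ℝ}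
    (hε : 0 < ε) {a : 𝔼 → ℝ} (ha : 0 ≤ᵐ[volume] a) (x : 𝔼) : 0 ≤ regularise ψ a ε x := by
  refine integral_nonneg_of_ae ?_
  filter_upwards [ae_sub_left ha x] with t ht
  exact mul_nonneg ((isFriedrichsMollifier_mollifyingNet hψ hε).nonneg t) ht

theorem IsFriedrichsMollifier.abs_regularise_le {ψ : 𝔼 → ℝ} (hψ : IsFriedrichsMollifier ψ) {ε : ℝ}
    (hε : 0 < ε) {a : 𝔼 → ℝ} (ha : MemLp a ∞ volume) (x : 𝔼) :
    ‖regularise ψ a ε x‖ ≤ (eLpNorm a ∞ volume).toReal := by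
  have hη := isFriedrichsMollifier_mollifyingNet hψ hε
  have hbound : ∀ᵐ y, ‖a y‖ ≤ (eLpNorm a ∞ volume).toReal := by
    filter_upwards [ae_le_eLpNormEssSup (f := a) (μ := volume)] with y hy
    rw [← eLpNorm_exponent_top] at hy
    rw [← toReal_enorm]
    exact ENNReal.toReal_mono ha.2.ne hy
  refine (norm_integral_le_of_norm_le (hη.integrable.mul_const (eLpNorm a ∞ volume).toReal)
    ?_).trans_eq ?_
  · filter_upwards [ae_sub_left hbound x] with t ht
    rw [ContinuousLinearMap.lsmul_apply, norm_smul, Real.norm_of_nonneg (hη.nonneg t)]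
    exact mul_le_mul_of_nonneg_left ht (hη.nonneg t)
  · rw [integral_mul_const, hη.integral_eq_one, one_mul]

theorem IsFriedrichsMollifier.memLp_regularise {ψ : 𝔼 → ℝ} (hψ : IsFriedrichsMollifier ψ) {ε : ℝ}
    (hε : 0 < ε) {a : 𝔼 → ℝ} (ha : MemLp a ∞ volume) : MemLp (regularise ψ a ε) ∞ volume := by
  have hη := isFriedrichsMollifier_mollifyingNet hψ hε
  exact memLp_top_of_bound (hη.hasCompactSupport.continuous_convolution_left _ hη.continuous
    (ha.locallyIntegrable le_top)).aestronglyMeasurable _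
    (Eventually.of_forall (hψ.abs_regularise_le hε ha))

theorem IsFriedrichsMollifier.eLpNorm_regularise_le {ψ : 𝔼 → ℝ} (hψ : IsFriedrichsMollifier ψ)
    {ε : ℝ} (hε : 0 < ε) {a : 𝔼 → ℝ} (ha : MemLp a ∞ volume) :
    eLpNorm (regularise ψ a ε) ∞ volume ≤ eLpNorm a ∞ volume := by
  rw [← ENNReal.ofReal_toReal ha.2.ne]
  refine (eLpNorm_le_of_ae_bound (Eventually.of_forall (hψ.abs_regularise_le hε ha))).trans ?_
  simp

end Mollification

/-! ### Cauchy solutions: existence, stability, very weak solutions -/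

section CauchyProblem

variable {d : ℕ} {s T : ℝ}

local notation "𝔼" => EuclideanSpace ℝ (Fin d)

/-- Multiplication by the real coefficient `a`, as a bounded operator on `L²`. -/
noncomputable def coeffOp (a : 𝔼 → ℝ) : L2Space d →L[ℂ] L2Space d :=
  mulL2 volume fun x => (a x : ℂ)

theorem norm_coeffOp_le {a : 𝔼 → ℝ} (ha : MemLp a ∞ volume) (f : L2Space d) :
    ‖coeffOp a f‖ ≤ (eLpNorm a ∞ volume).toReal * ‖f‖ := by
  refine (norm_mulL2_le ha.ofReal f).trans_eq ?_
  congr 2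
  exact eLpNorm_congr_norm_ae (Eventually.of_forall fun x => Complex.norm_real _)

theorem coeffOp_sub {a a' : 𝔼 → ℝ} (ha : MemLp a ∞ volume) (ha' : MemLp a' ∞ volume)
    (f : L2Space d) : coeffOp (a - a') f = coeffOp a f - coeffOp a' f := by
  refine Lp.ext ?_
  filter_upwards [coeFn_mulL2 (ha.sub ha').ofReal f, coeFn_mulL2 ha.ofReal f,
    coeFn_mulL2 ha'.ofReal f, Lp.coeFn_sub (coeffOp a f) (coeffOp a' f)] with x h1 h2 h3 h4
  have h1' : coeffOp (a - a') f x = _ := h1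
  have h2' : coeffOp a f x = _ := h2
  have h3' : coeffOp a' f x = _ := h3
  rw [h4, Pi.sub_apply, h1', h2', h3', ← sub_mul]
  simp

theorem integral_coeff_eq_inner {a b : 𝔼 → ℝ} (ha : MemLp a ∞ volume) (hb : MemLp b ∞ volume)
    (φ f g : L2Space d) :
    ∫ x, (starRingEnd ℂ) (φ x) * ((a x : ℂ) * f x + (b x : ℂ) * g x)
      = inner ℂ φ (coeffOp a f + coeffOp b g) := by
  rw [L2.inner_def]
  refine integral_congr_ae ?_
  filter_upwards [coeFn_mulL2 ha.ofReal f, coeFn_mulL2 hb.ofReal g,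
    Lp.coeFn_add (coeffOp a f) (coeffOp b g)] with x h1 h2 h3
  have h1' : coeffOp a f x = _ := h1
  have h2' : coeffOp b g x = _ := h2
  rw [h3, Pi.add_apply, h1', h2', RCLike.inner_apply, mul_comm]
  rfl

theorem IsCauchySolution.isForcedSolution (hT : 0 < T) {a b : 𝔼 → ℝ} (ha : MemLp a ∞ volume)
    (hb : MemLp b ∞ volume) {u₀ u₁ : 𝔼 → ℂ} {u : ℝ → L2Space d}
    (hu : IsCauchySolution s T a b u₀ u₁ u) :
    IsForcedSolution s T (fun t => coeffOp a (u t) + coeffOp b (timeDeriv T u t)) u where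
  energySpace := hu.energySpace
  continuousOn_forcing :=
    ((coeffOp a).continuous.comp_continuousOn hu.energySpace.contDiffOn.continuousOn).add
      ((coeffOp b).continuous.comp_continuousOn (hu.energySpace.continuousOn_timeDeriv hT))
  equation φ hφ t ht := by
    have h := hu.equation φ hφ t ht
    rwa [integral_coeff_eq_inner ha hb] at h

theorem exists_cauchySolution (hT : 0 < T) {a b : 𝔼 → ℝ} (ha : MemLp a ∞ volume)
    (hb : MemLp b ∞ volume) {u₀ u₁ : 𝔼 → ℂ} {g₀ g₁ : L2Space d} (hg₀ : g₀ ∈ sobolevHs d s)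
    (h₀ : g₀ =ᵐ[volume] u₀) (h₁ : g₁ =ᵐ[volume] u₁) :
    ∃ u, IsCauchySolution s T a b u₀ u₁ u := by
  obtain ⟨u, hu, hu0, hu1⟩ := exists_forcedSolution hT (coeffOp a) (coeffOp b) hg₀ g₁
  refine ⟨u, hu.energySpace, fun φ hφ t ht => ?_, by rw [hu0]; exact h₀, by rw [hu1]; exact h₁⟩
  rw [integral_coeff_eq_inner ha hb]
  exact hu.equation φ hφ t ht

/-- Continuous dependence on coefficients and data: the difference `z` of two solutions solves the
equation of the second one with the forcing term `(a' - a) u + (b' - b) u_t` added. -/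
theorem IsCauchySolution.norm_sub_sq_le (hT : 0 < T) {a b a' b' : 𝔼 → ℝ}
    (ha : MemLp a ∞ volume) (hb : MemLp b ∞ volume) (ha' : MemLp a' ∞ volume)
    (hb' : MemLp b' ∞ volume) {u₀ u₁ v₀ v₁ : 𝔼 → ℂ} {u v : ℝ → L2Space d}
    (hu : IsCauchySolution s T a b u₀ u₁ u) (hv : IsCauchySolution s T a' b' v₀ v₁ v) {L R : ℝ}
    (hLa : (eLpNorm a' ∞ volume).toReal ≤ L) (hLb : (eLpNorm b' ∞ volume).toReal ≤ L)
    (hR : ∀ t ∈ Icc 0 T, ‖u t‖ ≤ R) (hR' : ∀ t ∈ Icc 0 T, ‖timeDeriv T u t‖ ≤ R)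
    {t : ℝ} (ht : t ∈ Icc 0 T) :
    ‖v t - u t‖ ^ 2 ≤ gronwallBound (‖v 0 - u 0‖ ^ 2 + (‖timeDeriv T v 0 - timeDeriv T u 0‖ ^ 2
      + ‖fracLaplacianHalf s (v 0) - fracLaplacianHalf s (u 0)‖ ^ 2)) (3 * L + 2)
      (((eLpNorm (a' - a) ∞ volume).toReal * R + (eLpNorm (b' - b) ∞ volume).toReal * R) ^ 2)
      T := by
  have h0 : (0 : ℝ) ∈ Icc 0 T := ⟨le_rfl, hT.le⟩
  have hL : 0 ≤ L := ENNReal.toReal_nonneg.trans hLa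
  have hz := (hv.isForcedSolution hT ha' hb').sub hT (hu.isForcedSolution hT ha hb)
  have hzt : ∀ t ∈ Icc 0 T, timeDeriv T (fun t => v t - u t) t
      = timeDeriv T v t - timeDeriv T u t := fun t ht =>
    timeDeriv_sub hT hv.energySpace hu.energySpace ht
  have hE := hz.energy_le hT (L := L)
    (δ := (eLpNorm (a' - a) ∞ volume).toReal * R + (eLpNorm (b' - b) ∞ volume).toReal * R) hL
    (fun t ht => ?_) ht
  · rw [hzt 0 h0, fracLaplacianHalf_sub (hv.energySpace.mem_hs 0 h0) (hu.energySpace.mem_hs 0 h0)]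
      at hE
    exact (le_add_of_nonneg_right (by positivity)).trans hE
  · rw [hzt t ht]
    have e : coeffOp a' (v t) + coeffOp b' (timeDeriv T v t)
          - (coeffOp a (u t) + coeffOp b (timeDeriv T u t))
        = (coeffOp a' (v t - u t) + coeffOp b' (timeDeriv T v t - timeDeriv T u t))
          + (coeffOp (a' - a) (u t) + coeffOp (b' - b) (timeDeriv T u t)) := by
      rw [coeffOp_sub ha' ha, coeffOp_sub hb' hb, map_sub, map_sub]
      abel
    rw [e]
    refine (norm_add_le _ _).trans (add_le_add ((norm_add_le _ _).trans ?_)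
      ((norm_add_le _ _).trans ?_))
    · rw [mul_add]
      refine add_le_add ((norm_coeffOp_le ha' _).trans ?_) ((norm_coeffOp_le hb' _).trans ?_) <;>
      gcongr
    · refine add_le_add ((norm_coeffOp_le (ha'.sub ha) _).trans ?_)
        ((norm_coeffOp_le (hb'.sub hb) _).trans ?_)
      · exact mul_le_mul_of_nonneg_left (hR t ht) ENNReal.toReal_nonneg
      · exact mul_le_mul_of_nonneg_left (hR' t ht) ENNReal.toReal_nonneg

/-- A common bound on `[0,T]` for a curve of the energy space and its velocity. -/
theorem InEnergySpace.exists_bound (hT : 0 < T) {u : ℝ → L2Space d} (hu : InEnergySpace s T u) :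
    ∃ R, (∀ t ∈ Icc 0 T, ‖u t‖ ≤ R) ∧ ∀ t ∈ Icc 0 T, ‖timeDeriv T u t‖ ≤ R := by
  obtain ⟨R₁, h₁⟩ := isCompact_Icc.exists_bound_of_continuousOn hu.contDiffOn.continuousOn
  obtain ⟨R₂, h₂⟩ := isCompact_Icc.exists_bound_of_continuousOn (hu.continuousOn_timeDeriv hT)
  exact ⟨max R₁ R₂, fun t ht => (h₁ t ht).trans (le_max_left _ _),
    fun t ht => (h₂ t ht).trans (le_max_right _ _)⟩

theorem IsCauchySolution.eqOn (hT : 0 < T) {a b : 𝔼 → ℝ} (ha : MemLp a ∞ volume)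
    (hb : MemLp b ∞ volume) {u₀ u₁ : 𝔼 → ℂ} {u w : ℝ → L2Space d}
    (hu : IsCauchySolution s T a b u₀ u₁ u) (hw : IsCauchySolution s T a b u₀ u₁ w) :
    EqOn w u (Icc 0 T) := by
  intro t ht
  obtain ⟨R, hR, hR'⟩ := hu.energySpace.exists_bound hT
  have h := hu.norm_sub_sq_le hT ha hb ha hb hw (le_max_left _ _) (le_max_right _ _) hR hR' ht
  have e0 : w 0 = u 0 := Lp.ext (hw.initial_value.trans hu.initial_value.symm)
  have e1 : timeDeriv T w 0 = timeDeriv T u 0 :=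
    Lp.ext (hw.initial_velocity.trans hu.initial_velocity.symm)
  rw [e0, e1] at h
  simp only [sub_self, norm_zero, eLpNorm_zero, ENNReal.toReal_zero, zero_mul, add_zero, ne_eq,
    OfNat.ofNat_ne_zero, not_false_eq_true, zero_pow, gronwallBound_ε0_δ0] at h
  have h' : ‖w t - u t‖ ^ 2 = 0 := le_antisymm h (sq_nonneg _)
  exact sub_eq_zero.1 (norm_eq_zero.1 (pow_eq_zero_iff two_ne_zero |>.1 h'))

/-- The energy bound for a solution depends only on bounds for the coefficients and the data. -/
theorem IsCauchySolution.hsNorm_add_le (hT : 0 < T) {a b : 𝔼 → ℝ} (ha : MemLp a ∞ volume)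
    (hb : MemLp b ∞ volume) {u₀ u₁ : 𝔼 → ℂ} {u : ℝ → L2Space d}
    (hu : IsCauchySolution s T a b u₀ u₁ u) {L N : ℝ}
    (hLa : (eLpNorm a ∞ volume).toReal ≤ L) (hLb : (eLpNorm b ∞ volume).toReal ≤ L)
    (hN : ‖u 0‖ ^ 2 + (‖timeDeriv T u 0‖ ^ 2 + ‖fracLaplacianHalf s (u 0)‖ ^ 2) ≤ N)
    {t : ℝ} (ht : t ∈ Icc 0 T) :
    hsNorm s (u t) + ‖timeDeriv T u t‖ ≤ N * Real.exp ((3 * L + 2) * T) + 1 := by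
  have hL : 0 ≤ L := ENNReal.toReal_nonneg.trans hLa
  have hE := (hu.isForcedSolution hT ha hb).energy_le hT (L := L) (δ := 0) hL (fun t ht => ?_) ht
  · rw [zero_pow two_ne_zero, gronwallBound_ε0] at hE
    have h1 := hE.trans (mul_le_mul_of_nonneg_right hN (Real.exp_pos _).le)
    unfold hsNorm
    -- `x ≤ x² + 1/4` for each of the three norms
    nlinarith [sq_nonneg (‖u t‖ - 1 / 2), sq_nonneg (‖timeDeriv T u t‖ - 1 / 2),
      sq_nonneg (‖fracLaplacianHalf s (u t)‖ - 1 / 2)]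
  · rw [add_zero, mul_add]
    refine (norm_add_le _ _).trans (add_le_add ((norm_coeffOp_le ha _).trans ?_)
      ((norm_coeffOp_le hb _).trans ?_)) <;> gcongr

theorem IsFriedrichsMollifier.isLpModerate_top {ψ : 𝔼 → ℝ} (hψ : IsFriedrichsMollifier ψ)
    {a : 𝔼 → ℝ} (ha : MemLp a ∞ volume) : IsLpModerate ∞ (regularise ψ a) := by
  refine ⟨0, (eLpNorm a ∞ volume).toReal, fun ε hε => ⟨hψ.memLp_regularise hε.1 ha, ?_⟩⟩
  rw [pow_zero, div_one, ENNReal.ofReal_toReal ha.2.ne]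
  exact hψ.eLpNorm_regularise_le hε.1 ha

theorem IsFriedrichsMollifier.isLpModerate_two {ψ : 𝔼 → ℝ} (hψ : IsFriedrichsMollifier ψ)
    (f : L2Space d) : IsLpModerate 2 (regularise ψ f) := by
  refine ⟨0, ‖f‖, fun ε hε => ⟨(memLp_congr_ae (hψ.mollify_ae_eq hε.1 f)).1 (Lp.memLp _), ?_⟩⟩
  rw [pow_zero, div_one, ← eLpNorm_congr_ae (hψ.mollify_ae_eq hε.1 f), ← Lp.enorm_def,
    ← ofReal_norm]
  exact ENNReal.ofReal_le_ofReal (hψ.norm_mollify_le ε f)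

theorem IsFriedrichsMollifier.fracLaplacianHalf_mollify {ψ : 𝔼 → ℝ} (hψ : IsFriedrichsMollifier ψ)
    {f : L2Space d} (hf : f ∈ sobolevHs d s) (ε : ℝ) :
    fracLaplacianHalf s (mollify ψ ε f) = mollify ψ ε (fracLaplacianHalf s f) :=
  fracLaplacianHalf_fourierMult hf (hψ.memLp_mollify ε)

theorem IsFriedrichsMollifier.mollify_mem_sobolevHs {ψ : 𝔼 → ℝ} (hψ : IsFriedrichsMollifier ψ)
    {f : L2Space d} (hf : f ∈ sobolevHs d s) (ε : ℝ) : mollify ψ ε f ∈ sobolevHs d s :=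
  fourierMult_mem_sobolevHs hf (hψ.memLp_mollify ε)

theorem IsFriedrichsMollifier.isHsModerate {ψ : 𝔼 → ℝ} (hψ : IsFriedrichsMollifier ψ)
    {f : L2Space d} (hf : f ∈ sobolevHs d s) : IsHsModerate s (regularise ψ f) := by
  refine ⟨0, hsNorm s f, fun ε hε => ⟨mollify ψ ε f, hψ.mollify_mem_sobolevHs hf ε,
    hψ.mollify_ae_eq hε.1 f, ?_⟩⟩
  rw [pow_zero, div_one, hsNorm, hψ.fracLaplacianHalf_mollify hf]
  exact add_le_add (hψ.norm_mollify_le ε _) (hψ.norm_mollify_le ε _)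

theorem IsCauchySolution.initial_eq_mollify {ψ : 𝔼 → ℝ} (hψ : IsFriedrichsMollifier ψ) {ε : ℝ}
    (hε : 0 < ε) {a b : 𝔼 → ℝ} {u₀ u₁ : L2Space d} {v : ℝ → L2Space d}
    (hv : IsCauchySolution s T a b (regularise ψ u₀ ε) (regularise ψ u₁ ε) v) :
    v 0 = mollify ψ ε u₀ ∧ timeDeriv T v 0 = mollify ψ ε u₁ :=
  ⟨Lp.ext (hv.initial_value.trans (hψ.mollify_ae_eq hε u₀).symm),
    Lp.ext (hv.initial_velocity.trans (hψ.mollify_ae_eq hε u₁).symm)⟩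

theorem exists_veryWeakSolution (hT : 0 < T) {ψ : 𝔼 → ℝ} (hψ : IsFriedrichsMollifier ψ)
    {a b : 𝔼 → ℝ} (ha : MemLp a ∞ volume) (hb : MemLp b ∞ volume) (ha0 : 0 ≤ᵐ[volume] a)
    (hb0 : 0 ≤ᵐ[volume] b) {u₀ : L2Space d} (hu₀ : u₀ ∈ sobolevHs d s) (u₁ : L2Space d) :
    ∃ v, IsVeryWeakSolution s T (regularise ψ a) (regularise ψ b) (regularise ψ u₀)
      (regularise ψ u₁) v := by
  have hex : ∀ ε : ℝ, ∃ v, ε ∈ Ioc (0 : ℝ) 1 → IsCauchySolution s T (regularise ψ a ε)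
      (regularise ψ b ε) (regularise ψ u₀ ε) (regularise ψ u₁ ε) v := by
    intro ε
    by_cases hε : ε ∈ Ioc (0 : ℝ) 1
    · obtain ⟨v, hv⟩ := exists_cauchySolution hT (hψ.memLp_regularise hε.1 ha)
        (hψ.memLp_regularise hε.1 hb) (hψ.mollify_mem_sobolevHs hu₀ ε)
        (hψ.mollify_ae_eq hε.1 u₀) (hψ.mollify_ae_eq hε.1 u₁)
      exact ⟨v, fun _ => hv⟩
    · exact ⟨0, fun h => absurd h hε⟩
  choose v hv using hex
  refine ⟨v, hψ.isLpModerate_top ha, hψ.isLpModerate_top hb,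
    fun ε hε => Eventually.of_forall (hψ.regularise_nonneg hε.1 ha0),
    fun ε hε => Eventually.of_forall (hψ.regularise_nonneg hε.1 hb0),
    hψ.isHsModerate hu₀, hψ.isLpModerate_two u₁, hv, ?_⟩
  let L := max (eLpNorm a ∞ volume).toReal (eLpNorm b ∞ volume).toReal
  refine ⟨0, (‖u₀‖ ^ 2 + (‖u₁‖ ^ 2 + ‖fracLaplacianHalf s u₀‖ ^ 2)) *
    Real.exp ((3 * L + 2) * T) + 1, fun ε hε => ⟨(hv ε hε).energySpace, fun t ht => ?_⟩⟩
  rw [pow_zero, div_one]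
  obtain ⟨h0, h1⟩ := (hv ε hε).initial_eq_mollify hψ hε.1
  refine (hv ε hε).hsNorm_add_le hT (hψ.memLp_regularise hε.1 ha) (hψ.memLp_regularise hε.1 hb)
    ((ENNReal.toReal_mono ha.2.ne (hψ.eLpNorm_regularise_le hε.1 ha)).trans (le_max_left _ _))
    ((ENNReal.toReal_mono hb.2.ne (hψ.eLpNorm_regularise_le hε.1 hb)).trans (le_max_right _ _))
    ?_ ht
  rw [h0, h1, hψ.fracLaplacianHalf_mollify hu₀]
  gcongr <;> exact hψ.norm_mollify_le ε _

theorem tendstoUniformlyOn_of_isVeryWeakSolution (hT : 0 < T) {ψ : 𝔼 → ℝ}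
    (hψ : IsFriedrichsMollifier ψ) {a b : 𝔼 → ℝ} (ha : MemLp a ∞ volume) (hb : MemLp b ∞ volume)
    {u₀ : L2Space d} (hu₀ : u₀ ∈ sobolevHs d s) {u₁ : L2Space d}
    (ha_lim : Tendsto (fun ε => eLpNorm (regularise ψ a ε - a) ∞ volume) (𝓝[>] 0) (𝓝 0))
    (hb_lim : Tendsto (fun ε => eLpNorm (regularise ψ b ε - b) ∞ volume) (𝓝[>] 0) (𝓝 0))
    {u : ℝ → L2Space d} (hu : IsCauchySolution s T a b u₀ u₁ u) {v : ℝ → ℝ → L2Space d}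
    (hv : IsVeryWeakSolution s T (regularise ψ a) (regularise ψ b) (regularise ψ u₀)
      (regularise ψ u₁) v) : TendstoUniformlyOn v u (𝓝[>] 0) (Icc 0 T) := by
  obtain ⟨R, hR, hR'⟩ := hu.energySpace.exists_bound hT
  let L := max (eLpNorm a ∞ volume).toReal (eLpNorm b ∞ volume).toReal
  have hL : 0 ≤ L := ENNReal.toReal_nonneg.trans (le_max_left _ _)
  have e0 : u 0 = u₀ := Lp.ext hu.initial_value
  have e1 : timeDeriv T u 0 = u₁ := Lp.ext hu.initial_velocity
  let N : ℝ → ℝ := fun ε => ‖mollify ψ ε u₀ - u₀‖ ^ 2 + (‖mollify ψ ε u₁ - u₁‖ ^ 2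
    + ‖mollify ψ ε (fracLaplacianHalf s u₀) - fracLaplacianHalf s u₀‖ ^ 2)
  let δ : ℝ → ℝ := fun ε => (eLpNorm (regularise ψ a ε - a) ∞ volume).toReal * R
    + (eLpNorm (regularise ψ b ε - b) ∞ volume).toReal * R
  have hbound : ∀ ε ∈ Ioc (0 : ℝ) 1, ∀ t ∈ Icc 0 T,
      ‖v ε t - u t‖ ^ 2 ≤ gronwallBound (N ε) (3 * L + 2) (δ ε ^ 2) T := by
    intro ε hε t ht
    obtain ⟨h0, h1⟩ := (hv.solves ε hε).initial_eq_mollify hψ hε.1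
    have h := hu.norm_sub_sq_le hT ha hb (hψ.memLp_regularise hε.1 ha)
      (hψ.memLp_regularise hε.1 hb) (hv.solves ε hε) (L := L)
      ((ENNReal.toReal_mono ha.2.ne (hψ.eLpNorm_regularise_le hε.1 ha)).trans (le_max_left _ _))
      ((ENNReal.toReal_mono hb.2.ne (hψ.eLpNorm_regularise_le hε.1 hb)).trans (le_max_right _ _))
      hR hR' ht
    rwa [h0, h1, hψ.fracLaplacianHalf_mollify hu₀, e0, e1] at h
  have hNlim : Tendsto N (𝓝[>] 0) (𝓝 0) := by
    have hf : ∀ f : L2Space d, Tendsto (fun ε => ‖mollify ψ ε f - f‖ ^ 2) (𝓝[>] 0) (𝓝 0) := by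
      intro f
      simpa using (tendsto_iff_norm_sub_tendsto_zero.1 (hψ.tendsto_mollify f)).pow 2
    simpa using (hf u₀).add ((hf u₁).add (hf (fracLaplacianHalf s u₀)))
  have hδlim : Tendsto δ (𝓝[>] 0) (𝓝 0) := by
    have h1 := (ENNReal.tendsto_toReal ENNReal.zero_ne_top).comp ha_lim
    have h2 := (ENNReal.tendsto_toReal ENNReal.zero_ne_top).comp hb_lim
    simpa only [δ, Function.comp_apply, ENNReal.toReal_zero, zero_mul, add_zero]
      using (h1.mul_const R).add (h2.mul_const R)
  have hlim : Tendsto (fun ε => gronwallBound (N ε) (3 * L + 2) (δ ε ^ 2) T) (𝓝[>] 0) (𝓝 0) := by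
    have hK : 3 * L + 2 ≠ 0 := by positivity
    simp only [gronwallBound_of_K_ne_0 hK]
    simpa using (hNlim.mul_const (Real.exp ((3 * L + 2) * T))).add
      (((hδlim.pow 2).div_const (3 * L + 2)).mul_const (Real.exp ((3 * L + 2) * T) - 1))
  rw [Metric.tendstoUniformlyOn_iff]
  intro r hr
  filter_upwards [hlim.eventually_lt_const (pow_pos hr 2), Ioc_mem_nhdsGT one_pos] with ε h1 hε t ht
  rw [dist_comm, dist_eq_norm]
  exact lt_of_pow_lt_pow_left₀ 2 hr.le ((hbound ε hε t ht).trans_lt h1)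

end CauchyProblem

theorem theorem4p1 (d : ℕ) (s T : ℝ) (hs : 0 < s) (hT : 0 < T)
    (ψ : EuclideanSpace ℝ (Fin d) → ℝ) (hψ : IsFriedrichsMollifier ψ)
    (a b : EuclideanSpace ℝ (Fin d) → ℝ)
    (ha : MemLp a ∞ volume) (hb : MemLp b ∞ volume)
    (ha_nonneg : 0 ≤ᵐ[volume] a) (hb_nonneg : 0 ≤ᵐ[volume] b)
    (u₀ u₁ : L2Space d) (hu₀ : u₀ ∈ sobolevHs d s)
    (ha_lim : Tendsto (fun ε => eLpNorm (regularise ψ a ε - a) ∞ volume) (𝓝[>] 0) (𝓝 0))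
    (hb_lim : Tendsto (fun ε => eLpNorm (regularise ψ b ε - b) ∞ volume) (𝓝[>] 0) (𝓝 0)) :
    ∃ u : ℝ → L2Space d,
      IsCauchySolution s T a b u₀ u₁ u ∧
      (∀ w : ℝ → L2Space d, IsCauchySolution s T a b u₀ u₁ w → EqOn w u (Icc 0 T)) ∧
      (∃ v : ℝ → ℝ → L2Space d,
        IsVeryWeakSolution s T (regularise ψ a) (regularise ψ b)
          (regularise ψ u₀) (regularise ψ u₁) v) ∧
      ∀ v : ℝ → ℝ → L2Space d,
        IsVeryWeakSolution s T (regularise ψ a) (regularise ψ b)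
          (regularise ψ u₀) (regularise ψ u₁) v →
        TendstoUniformlyOn v u (𝓝[>] 0) (Icc 0 T) := by
  obtain ⟨u, hu⟩ := exists_cauchySolution hT ha hb hu₀ (ae_eq_refl u₀) (ae_eq_refl u₁)
  exact ⟨u, hu, fun w hw => hu.eqOn hT ha hb hw,
    exists_veryWeakSolution hT hψ ha hb ha_nonneg hb_nonneg hu₀ u₁,
    fun v hv => tendstoUniformlyOn_of_isVeryWeakSolution hT hψ ha hb hu₀ ha_lim hb_lim hu hv⟩
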